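/- Let $E$ be a Hausdorff, sequentially complete, barreled locally convex space over $\mathbb{C}$, let $L(E)$ be the space of continuous linear operators on $E$ (with the topology of uniform convergence on bounded sets), and let $C\in L(E)$, not necessarily injective. Let $\mathcal{D}=C_0^\infty(\mathbb{R})$ be the space of complex-valued test functions with its usual topology, and put $g_\beta(t)=t^{\beta-1}/\Gamma(\beta)$ for $\beta>0$, $t>0$; at $t=0$ read $g_1(0)=1$ and $g_\beta(0)=0$ for $\beta>1$. Integrals of $E$-valued functions are understood in the weak sense: $\int_M F(t)\,dt=v$ means that for every continuous linear functional $x^*$ on $E$ the function $\langle x^*,F(\cdot)\rangle$ is integrable on $M$ with integral $\langle x^*,v\rangle$. For $\alpha\ge 0$, a global $\alpha$-times integrated $C$-semigroup is a family $(S_\alpha(t))_{t\ge 0}\subseteq L(E)$ such that $t\mapsto S_\alpha(t)x$ is continuous on $[0,\infty)$ for every $x\in E$, $S_\alpha(t)C=CS_\alpha(t)$ for $t\ge0$, and, for all $t,s\ge 0$ and $x\in E$, $$S_\alpha(t)S_\alpha(s)x=\Bigl[\int_0^{t+s}-\int_0^t-\int_0^s\Bigr]g_\alpha(t+s-r)S_\alpha(r)Cx\,dr\quad\text{if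 }\alpha>0,\qquad S_0(t)S_0(s)x=S_0(t+s)Cx\quad\text{if }\alpha=0.$$ Its integral generator is the multivalued linear operator (linear relation) $$\Bigl\{(x,y)\in E\times E:\ S_\alpha(t)x-g_{\alpha+1}(t)Cx=\int_0^tS_\alpha(s)y\,ds\ \text{ for all }t\ge0\Bigr\}.$$ The Weyl fractional derivative of $\varphi\in\mathcal{D}$ is $W^n_+\varphi=(-1)^n\varphi^{(n)}$ for $n\in\mathbb{N}_0$ and, for $\alpha\in(0,\infty)\setminus\mathbb{N}$ and $n=\lceil\alpha\rceil$, $$W^\alpha_+\varphi(t)=\frac{(-1)^n}{\Gamma(n-\alpha)}\frac{d^n}{dt^n}\int_t^\infty(s-t)^{n-\alpha-1}\varphi(s)\,ds,\qquad t\in\mathbb{R}.$$ A pre-(C-DS) is a continuous linear map $\mathcal{G}:\mathcal{D}\to L(E)$ (an $L(E)$-valued distribution) with support in $[0,\infty)$ such that $C\mathcal{G}(\varphi)=\mathcal{G}(\varphi)C$ and $\mathcal{G}(\varphi*_0\psi)C=\mathcal{G}(\varphi)\mathcal{G}(\psi)$ for all $\varphi,\psi\in\mathcal{D}$, where $(\varphi*_0\psi)(t)=\int_0^t\varphi(t-s)\psi(s)\,ds$,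 $t\in\mathbb{R}$. Its (integral) generator is the multivalued linear operator $$\bigl\{(x,y)\in E\times E:\ \mathcal{G}(-\varphi')x=\mathcal{G}(\varphi)y\ \text{ for all }\varphi\in\mathcal{D}\text{ with }\operatorname{supp}\varphi\subseteq[0,\infty)\bigr\}.$$ **Theorem.** Let $\alpha\ge0$ and let $\mathcal{A}$ be the integral generator of a global $\alpha$-times integrated $C$-semigroup $(S_\alpha(t))_{t\ge0}$ on $E$. Then the integrals $$\mathcal{G}(\varphi)x=\int_0^\infty W^\alpha_+\varphi(t)\,S_\alpha(t)x\,dt,\qquad x\in E,\ \varphi\in\mathcal{D},$$ exist and define a pre-(C-DS) $\mathcal{G}$ whose integral generator contains $\mathcal{A}$. -/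

import Mathlib

open Set Filter Topology MeasureTheory TopologicalSpace
open scoped Distributions ContDiff Convolution

noncomputable section

namespace DegenerateCSemigroup

/-! ### Test functions on the real line -/

/-- The Schwartz space `𝒟 = C₀^∞(ℝ)` of complex-valued test functions on `ℝ`, with its canonical
(inductive limit) topology. -/
abbrev TestFn : Type := TestFunction (⊤ : Opens ℝ) ℂ ⊤

/-- The derivative `φ'` of a test function, as a test function. -/
def testDeriv (φ : TestFn) : TestFn where
  toFun := deriv φ
  contDiff' := (contDiff_infty_iff_deriv.mp φ.contDiff).2
  hasCompactSupport' := φ.hasCompactSupport.deriv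
  tsupport_subset' := fun _ _ => trivial

/-- The finite convolution `(φ *₀ ψ)(t) = ∫₀ᵗ φ(t - s) ψ(s) ds`, `t ∈ ℝ`. -/
def conv0Fun (φ ψ : ℝ → ℂ) (t : ℝ) : ℂ := ∫ s in (0 : ℝ)..t, φ (t - s) * ψ s

theorem conv0Fun_eq (φ ψ : TestFn) :
    conv0Fun φ ψ =
      ((Ioi (0 : ℝ)).indicator ψ) ⋆[ContinuousLinearMap.mul ℝ ℂ, volume] (φ : ℝ → ℂ) -
      ((Iio (0 : ℝ)).indicator φ) ⋆[ContinuousLinearMap.mul ℝ ℂ, volume] (ψ : ℝ → ℂ) := by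
  funext t
  have hint : Integrable (fun s => φ (t - s) * ψ s) := by
    refine Continuous.integrable_of_hasCompactSupport (by fun_prop) ?_
    exact ψ.hasCompactSupport.mul_left
  have h1 : (((Ioi (0 : ℝ)).indicator ψ) ⋆[ContinuousLinearMap.mul ℝ ℂ, volume] (φ : ℝ → ℂ)) t
      = ∫ s in Ioi (0 : ℝ), φ (t - s) * ψ s := by
    rw [convolution_def, ← integral_indicator measurableSet_Ioi]
    congr 1
    funext s
    by_cases hs : s ∈ Ioi (0 : ℝ) <;> simp [hs, indicator, mul_comm]
  have h2 : (((Iio (0 : ℝ)).indicator φ) ⋆[ContinuousLinearMap.mul ℝ ℂ, volume] (ψ : ℝ → ℂ)) t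
      = ∫ s in Ioi t, φ (t - s) * ψ s := by
    rw [convolution_def, ← integral_indicator measurableSet_Ioi,
      ← integral_sub_left_eq_self _ volume t]
    congr 1
    funext s
    by_cases hs : t < s <;> simp [hs, indicator]
  rw [Pi.sub_apply, h1, h2, conv0Fun,
    intervalIntegral.integral_Ioi_sub_Ioi' hint.integrableOn hint.integrableOn]

/-- `φ *₀ ψ` as a test function. -/
def conv0 (φ ψ : TestFn) : TestFn where
  toFun := conv0Fun φ ψ
  contDiff' := by
    rw [conv0Fun_eq]
    refine ContDiff.sub ?_ ?_
    · exact φ.hasCompactSupport.contDiff_convolution_right _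
        (((ψ.continuous.integrable_of_hasCompactSupport
          ψ.hasCompactSupport).indicator measurableSet_Ioi).locallyIntegrable) φ.contDiff
    · exact ψ.hasCompactSupport.contDiff_convolution_right _
        (((φ.continuous.integrable_of_hasCompactSupport
          φ.hasCompactSupport).indicator measurableSet_Iio).locallyIntegrable) ψ.contDiff
  hasCompactSupport' := by
    have hind : ∀ (s : Set ℝ) (f : TestFn), HasCompactSupport (s.indicator f) := fun s f =>
      f.hasCompactSupport.mono (by
        intro x hx
        have := indicator_apply_ne_zero.mp hx
        exact this.2)
    rw [conv0Fun_eq]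
    exact (HasCompactSupport.convolution _ (hind _ ψ) φ.hasCompactSupport).sub
      (HasCompactSupport.convolution _ (hind _ φ) ψ.hasCompactSupport)
  tsupport_subset' := fun _ _ => trivial

theorem conv0_apply (φ ψ : TestFn) (t : ℝ) :
    conv0 φ ψ t = ∫ s in (0 : ℝ)..t, φ (t - s) * ψ s := rfl

/-- The Weyl fractional derivative `W^α_+ f` of order `α ≥ 0`. With `n = ⌈α⌉`, it is
`(-1)ⁿ f⁽ⁿ⁾` if `α = n`, and
`(-1)ⁿ / Γ(n - α) · dⁿ/dtⁿ ∫_t^∞ (s - t)^(n - α - 1) f(s) ds` if `α` is not an integer. -/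
def weylDeriv (α : ℝ) (f : ℝ → ℂ) (t : ℝ) : ℂ :=
  if α = (⌈α⌉₊ : ℝ) then (-1) ^ ⌈α⌉₊ * iteratedDeriv ⌈α⌉₊ f t
  else (-1) ^ ⌈α⌉₊ / (Real.Gamma (⌈α⌉₊ - α) : ℂ) *
    iteratedDeriv ⌈α⌉₊
      (fun r => ∫ s in Ioi r, (((s - r) ^ ((⌈α⌉₊ : ℝ) - α - 1) : ℝ) : ℂ) * f s) t

/-- `g_α(t) = t^(α - 1) / Γ(α)` -/
def gFun (α t : ℝ) : ℝ := t ^ (α - 1) / Real.Gamma α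

/-! ### Vector-valued integrals, integrated semigroups, distribution semigroups -/

variable {E : Type*} [AddCommGroup E] [Module ℂ E] [TopologicalSpace E]

/-- `v = ∫_s F(t) dt` for an `E`-valued function `F`: every continuous linear functional `f` on `E`
makes `f ∘ F` Lebesgue integrable on `s`, with integral `f v`. In a Hausdorff locally convex
space there is at most one such `v`. -/
def HasVectorIntegral (F : ℝ → E) (s : Set ℝ) (v : E) : Prop :=
  ∀ f : E →L[ℂ] ℂ, IntegrableOn (fun t => f (F t)) s ∧ ∫ t in s, f (F t) = f v

theorem HasVectorIntegral.add {F G : ℝ → E} {s : Set ℝ} {v w : E}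
    (hF : HasVectorIntegral F s v) (hG : HasVectorIntegral G s w) :
    HasVectorIntegral (fun t => F t + G t) s (v + w) := fun f => by
  simp only [map_add]
  exact ⟨(hF f).1.add (hG f).1, by
    rw [integral_add (hF f).1 (hG f).1, (hF f).2, (hG f).2]⟩

theorem HasVectorIntegral.smul {F : ℝ → E} {s : Set ℝ} {v : E} (c : ℂ)
    (hF : HasVectorIntegral F s v) : HasVectorIntegral (fun t => c • F t) s (c • v) := fun f => by
  simp only [map_smul]
  exact ⟨(hF f).1.smul c, by rw [integral_smul, (hF f).2]⟩

/-- `(S(t))_{t ≥ 0} ⊆ L(E)` is a global `α`-times integrated `C`-semigroup (`α ≥ 0`); for `α = 0`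
this means a `C`-regularized semigroup. Only the values `S t` with `t ≥ 0` matter. -/
structure IsIntegratedCSemigroup (α : ℝ) (C : E →L[ℂ] E) (S : ℝ → E →L[ℂ] E) : Prop where
  /-- strong continuity -/
  continuousOn : ∀ x : E, ContinuousOn (fun t => S t x) (Ici 0)
  /-- `S(t) C = C S(t)` -/
  comm : ∀ t : ℝ, 0 ≤ t → ∀ x : E, S t (C x) = C (S t x)
  /-- for `α = 0`: `S(t + s) C = S(t) S(s)` -/
  mul_zero : α = 0 → ∀ t s : ℝ, 0 ≤ t → 0 ≤ s → ∀ x : E, S (t + s) (C x) = S t (S s x)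
  /-- for `α > 0`:
  `S(t) S(s) x = [∫_0^{t+s} - ∫_0^t - ∫_0^s] g_α(t + s - r) S(r) C x dr` -/
  mul_pos : 0 < α → ∀ t s : ℝ, 0 ≤ t → 0 ≤ s → ∀ x : E, ∃ I₁ I₂ I₃ : E,
    HasVectorIntegral (fun r => (gFun α (t + s - r) : ℂ) • S r (C x)) (Ioc 0 (t + s)) I₁ ∧
    HasVectorIntegral (fun r => (gFun α (t + s - r) : ℂ) • S r (C x)) (Ioc 0 t) I₂ ∧
    HasVectorIntegral (fun r => (gFun α (t + s - r) : ℂ) • S r (C x)) (Ioc 0 s) I₃ ∧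
    S t (S s x) = I₁ - I₂ - I₃

section

variable [IsTopologicalAddGroup E] [ContinuousSMul ℂ E]

/-- The integral generator of a global `α`-times integrated `C`-semigroup, a multivalued linear
operator in `E` identified with its graph: the pairs `(x, y)` such that
`S(t) x - g_{α+1}(t) C x = ∫_0^t S(s) y ds` for all `t ≥ 0`. -/
def integralGenerator (α : ℝ) (C : E →L[ℂ] E) (S : ℝ → E →L[ℂ] E) : Submodule ℂ (E × E) where
  carrier := {p | ∀ t : ℝ, 0 ≤ t →
    HasVectorIntegral (fun s => S s p.2) (Ioc 0 t) (S t p.1 - (gFun (α + 1) t : ℂ) • C p.1)}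
  add_mem' := by
    intro p q hp hq t ht
    have h := (hp t ht).add (hq t ht)
    have e : S t (p + q).1 - (gFun (α + 1) t : ℂ) • C (p + q).1 =
        (S t p.1 - (gFun (α + 1) t : ℂ) • C p.1) + (S t q.1 - (gFun (α + 1) t : ℂ) • C q.1) := by
      simp only [Prod.fst_add, map_add, smul_add]
      abel
    rw [e]
    simpa only [Prod.snd_add, map_add] using h
  zero_mem' := by
    intro t ht f
    simp
  smul_mem' := by
    intro c p hp t ht
    have h := (hp t ht).smul c
    have e : S t (c • p).1 - (gFun (α + 1) t : ℂ) • C (c • p).1 =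
        c • (S t p.1 - (gFun (α + 1) t : ℂ) • C p.1) := by
      simp only [Prod.smul_fst, map_smul, smul_sub, smul_comm c]
    rw [e]
    simpa only [Prod.smul_snd, map_smul] using h

/-- `G ∈ 𝒟'(L(E)) = L(𝒟, L(E))` is a pre-(C-DS). Here `L(E)` carries the topology of uniform
convergence on bounded sets. -/
structure IsPreCDS (C : E →L[ℂ] E) (G : TestFn →L[ℂ] (E →L[ℂ] E)) : Prop where
  /-- the support of `G` is contained in `[0, ∞)` -/
  support : ∀ φ : TestFn, tsupport φ ⊆ Iio 0 → G φ = 0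
  /-- `C G = G C` -/
  comm : ∀ φ : TestFn, C ∘L G φ = G φ ∘L C
  /-- `G(φ *₀ ψ) C = G(φ) G(ψ)` -/
  mul : ∀ φ ψ : TestFn, G (conv0 φ ψ) ∘L C = G φ ∘L G ψ

/-- The (integral, infinitesimal) generator `G(-δ')` of `G`: the pairs `(x, y)` such that
`G((-δ') * φ) x = G(φ) y` for all test functions `φ` supported in `[0, ∞)`, where
`(-δ') * φ = -φ'`. -/
def distGenerator (G : TestFn →L[ℂ] (E →L[ℂ] E)) : Submodule ℂ (E × E) where
  carrier := {p | ∀ φ : TestFn, tsupport φ ⊆ Ici 0 → G (-testDeriv φ) p.1 = G φ p.2}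
  add_mem' := by
    intro p q hp hq φ hφ
    simp only [Prod.fst_add, Prod.snd_add, map_add, hp φ hφ, hq φ hφ]
  zero_mem' := by
    intro φ _
    simp
  smul_mem' := by
    intro c p hp φ hφ
    simp only [Prod.smul_fst, Prod.smul_snd, map_smul, hp φ hφ]

end

end DegenerateCSemigroup

end

/-! Existence. If `φ` vanishes beyond `R`, so does its Weyl derivative, and the integral runs over
`[0, R]`. Riemann sums of the strongly continuous integrand converge by sequential completeness;
since `E` is barrelled, the pointwise limit is a continuous operator (`exists_integral_clm`).
Continuity in `φ` follows from equicontinuity of `S` on compact intervals and a bound of `W^α φ` by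
the supremum of `|φ⁽ⁿ⁾|`, `n = ⌈α⌉` (`exists_distribution`). Functionals separate points, so every
further identity is scalar.

Let `I^β` be the right-sided fractional integral (`fracInt`). Then `I^β I^γ = I^(β+γ)` by the beta
integral, `W^α φ = (-1)ⁿ I^(n-α) φ⁽ⁿ⁾`, and hence `I^α W^α φ = φ`. For `α > 0`, `I^α` is injective
up to null sets on bounded functions vanishing far to the right.

Product formula, `α > 0`. Let `U`, `V` be `W^α φ`, `W^α ψ` restricted to `(0, ∞)`. Inserting the
semigroup law into `G(φ) G(ψ) x` and applying Fubini gives the integral of `S(r) C x` against `k(r)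
= ∬ U(a) V(b) g_α(a + b - r) [1 - 1_{r<a} - 1_{r<b}] da db`. It remains to see that `k = W^α(φ *₀
ψ)` almost everywhere on `(0, ∞)`; by injectivity, `I^α k = φ *₀ ψ` there is enough. In `I^α k(τ)`
the product `g_α(r - τ) g_α(a + b - r)` is invariant under `r ↦ a + b + τ - r`, which turns `r < b`
into `r > a + τ`; the bracket then leaves only `a ≤ r ≤ a + τ`. With `r = a + σ` the integral
factors into `∫₀^τ I^α U(τ - σ) I^α V(σ) dσ = (φ *₀ ψ)(τ)`. For `α = 0` the substitution `r = t + s`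
suffices.

Generator. Integrate the defining relation of `(x, y) ∈ A` against `W^α(-φ')`. The `g_{α+1}` term
gives `I^(α+1) W^α(-φ')(0) = φ(0) = 0`, and Fubini with `I^1 W^α(-φ') = W^α φ` turns the primitive
into `G(φ) y`. -/

noncomputable section

namespace DegenerateCSemigroup

/-! ### Weak integrals as limits of Riemann sums. -/

section WeakIntegral

theorem sum_range_mul_div {M : Type*} [AddCommMonoid M] (h : ℕ → M) (m : ℕ) {d : ℕ} (hd : 0 < d) :
    ∑ j ∈ Finset.range (m * d), h (j / d) = d • ∑ i ∈ Finset.range m, h i := by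
  induction m with
  | zero => simp
  | succ m ih =>
    rw [Nat.succ_mul, Finset.sum_range_add, ih, Finset.sum_range_succ, smul_add]
    congr 1
    rw [Finset.sum_congr rfl (g := fun _ => h m)]
    · simp
    · intro j hj
      rw [Finset.mem_range] at hj
      congr 1
      rw [mul_comm, Nat.mul_add_div hd, Nat.div_eq_of_lt hj, add_zero]

open ComplexOrder in
-- The nonnegative elements of `ℂ` in its partial order are the nonnegative reals, so real and
-- complex convexity agree.
theorem locallyConvexSpace_complex (E : Type*) [AddCommGroup E] [Module ℂ E] [Module ℝ E]
    [IsScalarTower ℝ ℂ E] [TopologicalSpace E] [LocallyConvexSpace ℝ E] :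
    LocallyConvexSpace ℂ E := by
  refine LocallyConvexSpace.ofBases ℂ E (fun x => id) (fun x s => s ∈ 𝓝 x ∧ Convex ℝ s)
    (fun x => LocallyConvexSpace.convex_basis x) ?_
  rintro x s ⟨-, hs⟩
  exact convex_of_nonneg_surjective_algebraMap _
    (fun _ h => RCLike.nonneg_iff_exists_ofReal.mp h) hs

theorem polynormableSpace_of_real (E : Type*) [AddCommGroup E] [Module ℂ E] [Module ℝ E]
    [IsScalarTower ℝ ℂ E] [TopologicalSpace E] [IsTopologicalAddGroup E] [ContinuousSMul ℂ E]
    [LocallyConvexSpace ℝ E] : PolynormableSpace ℂ E := by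
  have := locallyConvexSpace_complex E
  have : ContinuousSMul ℝ E := IsScalarTower.continuousSMul ℂ
  exact LocallyConvexSpace.toPolynormableSpace

/-- The left Riemann sum of `F` over `[0, b]` with `N` equal parts. -/
def riemannSum {E : Type*} [AddCommGroup E] [Module ℂ E] (b : ℝ) (F : ℝ → E) (N : ℕ) : E :=
  ((b / N : ℝ) : ℂ) • ∑ i ∈ Finset.range N, F (i * (b / N))

theorem map_riemannSum {E : Type*} [AddCommGroup E] [Module ℂ E] [TopologicalSpace E]
    (f : E →L[ℂ] ℂ) (b : ℝ) (F : ℝ → E) (N : ℕ) :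
    f (riemannSum b F N) = riemannSum b (fun t => f (F t)) N := by
  simp [riemannSum, map_smul, map_sum]

theorem grid_mem_Icc {b : ℝ} (hb : 0 < b) {N i : ℕ} (hi : i < N) :
    (i : ℝ) * (b / N) ∈ Icc 0 b := by
  have hN : (0 : ℝ) < N := by exact_mod_cast (Nat.zero_le i).trans_lt hi
  refine ⟨by positivity, ?_⟩
  have h : (i : ℝ) ≤ N := by exact_mod_cast hi.le
  calc (i : ℝ) * (b / N) ≤ N * (b / N) := by gcongr
    _ = b := by field_simp

theorem seminorm_riemannSum_le {E : Type*} [AddCommGroup E] [Module ℂ E] (p : Seminorm ℂ E)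
    {b : ℝ} (hb : 0 < b) {F : ℝ → E} {M : ℝ} (hM : ∀ t ∈ Icc 0 b, p (F t) ≤ M) (N : ℕ) :
    p (riemannSum b F N) ≤ b * M := by
  have hM0 : 0 ≤ M := (apply_nonneg p _).trans (hM 0 ⟨le_rfl, hb.le⟩)
  rcases Nat.eq_zero_or_pos N with rfl | hN
  · simpa [riemannSum] using mul_nonneg hb.le hM0
  have hN' : (0 : ℝ) < N := by exact_mod_cast hN
  rw [riemannSum, map_smul_eq_mul, Complex.norm_real, Real.norm_of_nonneg (by positivity)]
  calc b / N * p (∑ i ∈ Finset.range N, F (i * (b / N)))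
      ≤ b / N * ∑ i ∈ Finset.range N, M := by
        gcongr
        refine (Finset.le_sum_of_subadditive p (map_zero p).le (map_add_le_add p) _ _).trans
          (Finset.sum_le_sum fun i hi => hM _ ?_)
        exact grid_mem_Icc hb (Finset.mem_range.1 hi)
    _ = b * M := by
        simp only [Finset.sum_const, Finset.card_range, nsmul_eq_mul]
        field_simp

theorem seminorm_riemannSum_sub_mul_le {E : Type*} [AddCommGroup E] [Module ℂ E]
    (p : Seminorm ℂ E) {b δ ε : ℝ} (hb : 0 < b) {F : ℝ → E}
    (hF : ∀ s ∈ Icc 0 b, ∀ t ∈ Icc 0 b, |s - t| < δ → p (F s - F t) ≤ ε)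
    {N M : ℕ} (hN : 0 < N) (hM : 0 < M) (hδ : b / N < δ) :
    p (riemannSum b F N - riemannSum b F (N * M)) ≤ b * ε := by
  have hN' : (0 : ℝ) < N := by exact_mod_cast hN
  have hM' : (0 : ℝ) < M := by exact_mod_cast hM
  -- The coarse sum is written on the fine grid, each value repeated `M` times; the fine point `j`
  -- is then compared with the coarse point `j / M` to its left, less than `b / N` away.
  have h1 : riemannSum b F N = ((b / (N * M : ℕ) : ℝ) : ℂ) •
      ∑ j ∈ Finset.range (N * M), F ((j / M : ℕ) * (b / N)) := by
    rw [sum_range_mul_div (fun i : ℕ => F (i * (b / N))) N hM, riemannSum, ← Nat.cast_smul_eq_nsmul ℂ,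
      smul_smul]
    congr 1
    push_cast
    have : (M : ℂ) ≠ 0 := by exact_mod_cast hM.ne'
    field_simp
  rw [h1, riemannSum, ← smul_sub, ← Finset.sum_sub_distrib, map_smul_eq_mul, Complex.norm_real,
    Real.norm_of_nonneg (by positivity)]
  calc b / (N * M : ℕ) * p (∑ j ∈ Finset.range (N * M),
          (F ((j / M : ℕ) * (b / N)) - F (j * (b / (N * M : ℕ)))))
      ≤ b / (N * M : ℕ) * ∑ j ∈ Finset.range (N * M), ε := by
        gcongr
        refine (Finset.le_sum_of_subadditive p (map_zero p).le (map_add_le_add p) _ _).trans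
          (Finset.sum_le_sum fun j hj => ?_)
        have hj' := Finset.mem_range.1 hj
        have hq : j / M < N := Nat.div_lt_of_lt_mul (by rwa [mul_comm] at hj')
        refine hF _ (grid_mem_Icc hb hq) _ (grid_mem_Icc hb hj') ?_
        have e1 : ((j / M : ℕ) : ℝ) ≤ j / M := Nat.cast_div_le
        have e2 : (j : ℝ) / M < (j / M : ℕ) + 1 := by
          rw [div_lt_iff₀ hM']
          have h3 : j < (j / M + 1) * M := by
            rw [mul_comm]; exact Nat.lt_mul_div_succ j hM
          exact_mod_cast h3
        have e3 : (j : ℝ) * (b / (N * M : ℕ)) = j / M * (b / N) := by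
          push_cast; field_simp
        rw [e3, ← sub_mul, abs_mul, abs_of_pos (div_pos hb hN')]
        refine lt_of_le_of_lt ?_ hδ
        have : |((j / M : ℕ) : ℝ) - j / M| ≤ 1 := by
          rw [abs_le]; constructor <;> linarith
        calc _ ≤ 1 * (b / N) := by gcongr
          _ = b / N := one_mul _
    _ = b * ε := by
        simp only [Finset.sum_const, Finset.card_range, nsmul_eq_mul]
        push_cast
        field_simp

variable {E : Type*} [AddCommGroup E] [Module ℂ E] [UniformSpace E] [IsUniformAddGroup E]

theorem exists_modulus (p : Seminorm ℂ E) (hp : Continuous p) {b : ℝ} {F : ℝ → E}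
    (hF : ContinuousOn F (Icc 0 b)) {ε : ℝ} (hε : 0 < ε) :
    ∃ δ > 0, ∀ s ∈ Icc 0 b, ∀ t ∈ Icc 0 b, |s - t| < δ → p (F s - F t) ≤ ε := by
  have hu := isCompact_Icc.uniformContinuousOn_of_continuous hF
  have hV : {x : E | p x < ε} ∈ 𝓝 (0 : E) := by
    refine (isOpen_lt hp continuous_const).mem_nhds ?_
    simpa using hε
  have hV' : {q : E × E | p (q.1 - q.2) < ε} ∈ uniformity E := by
    rw [uniformity_eq_comap_nhds_zero_swapped]
    exact ⟨_, hV, fun q hq => hq⟩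
  rw [UniformContinuousOn, Metric.uniformity_basis_dist.inf_principal _ |>.tendsto_left_iff] at hu
  obtain ⟨δ, hδ, h⟩ := hu _ hV'
  refine ⟨δ, hδ, fun s hs t ht hst => le_of_lt ?_⟩
  have := @h (s, t) ⟨by simpa [Real.dist_eq] using hst, hs, ht⟩
  simpa using this

theorem cauchySeq_riemannSum [ContinuousSMul ℂ E] [PolynormableSpace ℂ E] {b : ℝ} (hb : 0 < b)
    {F : ℝ → E} (hF : ContinuousOn F (Icc 0 b)) : CauchySeq (riemannSum b F) := by
  have hw := PolynormableSpace.withSeminorms ℂ E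
  rw [cauchySeq_iff_tendsto, uniformity_eq_comap_nhds_zero_swapped, tendsto_comap_iff,
    hw.tendsto_nhds]
  rintro ⟨p, hp⟩ ε hε
  obtain ⟨δ, hδ, h⟩ := exists_modulus p hp hF (ε := ε / (4 * b)) (by positivity)
  have h0 : Tendsto (fun N : ℕ => b / N) atTop (𝓝 0) :=
    tendsto_const_div_atTop_nhds_zero_nat b
  have h1 : ∀ᶠ N : ℕ in atTop, b / N < δ ∧ 0 < N :=
    (h0.eventually_lt_const hδ).and (eventually_gt_atTop 0)
  rw [← prod_atTop_atTop_eq]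
  -- Both sums are compared with the one on the common refinement into `N * M` parts.
  filter_upwards [h1.prod_mk h1] with ⟨N, M⟩ ⟨⟨hN, hN0⟩, hM, hM0⟩
  have a1 := seminorm_riemannSum_sub_mul_le p hb h hN0 hM0 hN
  have a2 := seminorm_riemannSum_sub_mul_le p hb h hM0 hN0 hM
  rw [mul_comm M N] at a2
  simp only [Function.comp, Prod.map, sub_zero] at *
  have a3 : p (riemannSum b F N - riemannSum b F M) ≤
      p (riemannSum b F N - riemannSum b F (N * M)) +
        p (riemannSum b F M - riemannSum b F (N * M)) := by
    have := map_sub_le_add p (riemannSum b F N - riemannSum b F (N * M))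
      (riemannSum b F M - riemannSum b F (N * M))
    rwa [sub_sub_sub_cancel_right] at this
  have : b * (ε / (4 * b)) = ε / 4 := by field_simp
  rw [this] at a1 a2
  show p _ < ε
  linarith

theorem tendsto_riemannSum_complex {b : ℝ} (hb : 0 < b) {F : ℝ → ℂ}
    (hF : ContinuousOn F (Icc 0 b)) :
    Tendsto (riemannSum b F) atTop (𝓝 (∫ t in Ioc 0 b, F t)) := by
  rw [Metric.tendsto_nhds]
  intro ε hε
  obtain ⟨δ, hδ, h⟩ := exists_modulus (normSeminorm ℂ ℂ) continuous_norm hF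
    (ε := ε / (2 * b)) (by positivity)
  have h0 : Tendsto (fun N : ℕ => b / N) atTop (𝓝 0) :=
    tendsto_const_div_atTop_nhds_zero_nat b
  filter_upwards [h0.eventually_lt_const hδ, eventually_gt_atTop 0] with N hN hN0
  have hN' : (0 : ℝ) < N := by exact_mod_cast hN0
  have hc : 0 < b / N := by positivity
  have hmem : ∀ i < N, ∀ t ∈ Icc (i * (b / N)) ((i + 1 : ℕ) * (b / N)), t ∈ Icc 0 b := by
    intro i hi t ht
    have h1 := grid_mem_Icc hb hi
    have h3 : ((i + 1 : ℕ) : ℝ) ≤ N := by exact_mod_cast hi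
    have h2 : ((i + 1 : ℕ) : ℝ) * (b / N) ≤ b := by
      calc _ ≤ N * (b / N) := by gcongr
        _ = b := by field_simp
    exact ⟨h1.1.trans ht.1, ht.2.trans h2⟩
  have hle : ∀ i : ℕ, (i : ℝ) * (b / N) ≤ ((i + 1 : ℕ) : ℝ) * (b / N) := by
    intro i; push_cast; nlinarith
  have hint : ∀ i < N, IntervalIntegrable F volume (i * (b / N)) ((i + 1 : ℕ) * (b / N)) := by
    intro i hi
    refine ContinuousOn.intervalIntegrable ?_
    rw [uIcc_of_le (hle i)]
    exact hF.mono (hmem i hi)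
  have hsum : ∫ t in Ioc 0 b, F t =
      ∑ i ∈ Finset.range N, ∫ t in (i * (b / N))..((i + 1 : ℕ) * (b / N)), F t := by
    rw [intervalIntegral.sum_integral_adjacent_intervals
      (a := fun i : ℕ => (i : ℝ) * (b / N)) hint]
    rw [show ((0 : ℕ) : ℝ) * (b / N) = 0 by simp, show (N : ℝ) * (b / N) = b by field_simp,
      intervalIntegral.integral_of_le hb.le]
  rw [dist_eq_norm, hsum, riemannSum, Finset.smul_sum, ← Finset.sum_sub_distrib]
  calc _ ≤ ∑ i ∈ Finset.range N, ε / (2 * b) * (b / N) := by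
        refine (norm_sum_le _ _).trans (Finset.sum_le_sum fun i hi => ?_)
        have hi' := Finset.mem_range.1 hi
        have hlen : ((i + 1 : ℕ) : ℝ) * (b / N) - i * (b / N) = b / N := by push_cast; ring
        have e : ((b / N : ℝ) : ℂ) • F (i * (b / N)) =
            ∫ t in (i * (b / N))..((i + 1 : ℕ) * (b / N)), F (i * (b / N)) := by
          rw [intervalIntegral.integral_const, hlen]
          simp
        rw [e, ← intervalIntegral.integral_sub (by simp) (hint i hi')]
        have := intervalIntegral.norm_integral_le_of_norm_le_const (C := ε / (2 * b))
          (f := fun t => F (i * (b / N)) - F t)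
          (a := i * (b / N)) (b := (i + 1 : ℕ) * (b / N)) ?_
        · rwa [hlen, abs_of_pos hc] at this
        · intro t ht
          rw [uIoc_of_le (hle i)] at ht
          refine h _ (grid_mem_Icc hb hi') _ (hmem i hi' t ⟨ht.1.le, ht.2⟩) ?_
          rw [abs_sub_comm, abs_of_pos (sub_pos.2 ht.1)]
          linarith [ht.2]
    _ = ε / 2 := by
        simp only [Finset.sum_const, Finset.card_range, nsmul_eq_mul]
        field_simp
    _ < ε := by linarith

/-- Functionals separate points by Hahn–Banach. This is what reduces operator identities to scalar
ones. -/
theorem HasVectorIntegral.unique {E : Type*} [AddCommGroup E] [Module ℂ E] [Module ℝ E]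
    [IsScalarTower ℝ ℂ E] [TopologicalSpace E] [IsTopologicalAddGroup E] [ContinuousSMul ℂ E]
    [LocallyConvexSpace ℝ E] [T2Space E] {F : ℝ → E} {s : Set ℝ} {v w : E}
    (hv : HasVectorIntegral F s v) (hw : HasVectorIntegral F s w) : v = w := by
  by_contra hne
  obtain ⟨f, hf⟩ := RCLike.geometric_hahn_banach_point_point (𝕜 := ℂ) hne
  rw [← (hv f).2, ← (hw f).2] at hf
  exact lt_irrefl _ hf

/-- In a sequentially complete barrelled locally convex space, the weak integral over `[0, b]` of a
strongly continuous family of operators is a continuous operator. -/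
theorem exists_integral_clm [Module ℝ E] [IsScalarTower ℝ ℂ E] [ContinuousSMul ℂ E]
    [LocallyConvexSpace ℝ E] [T2Space E] [BarrelledSpace ℂ E]
    (hE : ∀ u : ℕ → E, CauchySeq u → ∃ x : E, Tendsto u atTop (𝓝 x))
    {b : ℝ} (hb : 0 < b) (T : ℝ → E →L[ℂ] E)
    (hT : ∀ x, ContinuousOn (fun t => T t x) (Icc 0 b)) :
    ∃ L : E →L[ℂ] E, (∀ x, HasVectorIntegral (fun t => T t x) (Ioc 0 b) (L x)) ∧
      ∀ (p : Seminorm ℂ E), Continuous p → ∀ (x : E) (M : ℝ),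
        (∀ t ∈ Icc 0 b, p (T t x) ≤ M) → p (L x) ≤ b * M := by
  have := polynormableSpace_of_real E
  choose ℓ hℓ using fun x => hE _ (cauchySeq_riemannSum hb (hT x))
  let g : ℕ → E →L[ℂ] E := fun N =>
    ((b / N : ℝ) : ℂ) • ∑ i ∈ Finset.range N, T (i * (b / N))
  have hg : ∀ N x, g N x = riemannSum b (fun t => T t x) N := by
    intro N x
    simp [g, riemannSum]
  have hlim : Tendsto (fun N x => g N x) atTop (𝓝 ℓ) := by
    rw [tendsto_pi_nhds]
    intro x
    simpa only [hg] using! hℓ x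
  -- Barrelledness enters here: by Banach–Steinhaus a pointwise limit of a sequence of continuous
  -- operators is continuous.
  refine ⟨continuousLinearMapOfTendsto g hlim, fun x f => ?_, fun p hp x M hM => ?_⟩
  · have hc : ContinuousOn (fun t => f (T t x)) (Icc 0 b) := f.continuous.comp_continuousOn (hT x)
    refine ⟨(hc.integrableOn_Icc).mono_set Ioc_subset_Icc_self, ?_⟩
    refine tendsto_nhds_unique (tendsto_riemannSum_complex hb hc) ?_
    refine ((f.continuous.tendsto _).comp (hℓ x)).congr fun N => ?_
    exact map_riemannSum f b _ N
  · refine le_of_tendsto ((hp.tendsto _).comp (hℓ x)) (Eventually.of_forall fun N => ?_)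
    exact seminorm_riemannSum_le p hb hM N

end WeakIntegral

/-! ### Operator-valued distributions defined by integration against `S`. -/

theorem exists_seminorm_ball_subset {E : Type*} [AddCommGroup E] [Module ℂ E] [TopologicalSpace E]
    [IsTopologicalAddGroup E] [PolynormableSpace ℂ E] {V : Set E} (hV : V ∈ 𝓝 (0 : E)) :
    ∃ p : Seminorm ℂ E, Continuous p ∧ ∃ r > 0, ∀ x, p x < r → x ∈ V := by
  have hw := PolynormableSpace.withSeminorms ℂ E
  obtain ⟨s, r, hr, hs⟩ := (hw.mem_nhds_iff _ _).1 hV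
  refine ⟨s.sup (fun p : {p : Seminorm ℂ E // Continuous p} => p.1), ?_, r, hr, fun x hx => ?_⟩
  · clear hs
    induction s using Finset.cons_induction with
    | empty => exact continuous_const
    | cons a s ha ih =>
      rw [Finset.sup_cons]
      exact a.2.max ih
  · exact hs (by simpa [Seminorm.mem_ball] using hx)

section Distribution

variable {E : Type*} [AddCommGroup E] [Module ℂ E] [Module ℝ E] [IsScalarTower ℝ ℂ E]
    [UniformSpace E] [IsUniformAddGroup E] [ContinuousSMul ℂ E] [LocallyConvexSpace ℝ E]
    [T2Space E] [BarrelledSpace ℂ E]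

omit [T2Space E] in
/-- A strongly continuous family of operators is equicontinuous on compact time intervals. -/
theorem exists_seminorm_bound {S : ℝ → E →L[ℂ] E}
    (hS : ∀ x : E, ContinuousOn (fun t => S t x) (Ici 0)) (R : ℝ) (p : Seminorm ℂ E)
    (hp : Continuous p) :
    ∃ q : Seminorm ℂ E, Continuous q ∧ ∀ t ∈ Icc 0 R, ∀ x, p (S t x) ≤ q x := by
  have := polynormableSpace_of_real E
  have hw := PolynormableSpace.withSeminorms ℂ E
  have hbs : UniformEquicontinuous
      ((fun T : E →L[ℂ] E => (T : E → E)) ∘ fun t : Icc (0 : ℝ) R => S t) := by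
    -- Orbits are continuous, hence bounded on the compact interval; barrelledness upgrades this
    -- pointwise bound to equicontinuity.
    refine hw.banach_steinhaus ?_
    rintro ⟨k, hk⟩ x
    have hc : ContinuousOn (fun t => k (S t x)) (Icc 0 R) :=
      hk.comp_continuousOn ((hS x).mono Icc_subset_Ici_self)
    refine (isCompact_Icc.bddAbove_image hc).mono ?_
    rintro _ ⟨t, rfl⟩
    exact ⟨t, t.2, rfl⟩
  have htfae := hw.equicontinuous_TFAE (fun t : Icc (0 : ℝ) R => (S t : E →ₗ[ℂ] E))
  obtain ⟨q, hq, h⟩ := (htfae.out 2 3 rfl rfl).1 hbs ⟨p, hp⟩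
  exact ⟨q, hq, fun t ht x => h ⟨t, ht⟩ x⟩

/-- Operator valued distributions `φ ↦ ∫_0^∞ W φ(t) S(t) dt` for a linear operation `W` on
test functions that is controlled by one derivative. -/
theorem exists_distribution (hE : ∀ u : ℕ → E, CauchySeq u → ∃ x : E, Tendsto u atTop (𝓝 x))
    {S : ℝ → E →L[ℂ] E} (hS : ∀ x : E, ContinuousOn (fun t => S t x) (Ici 0))
    (W : TestFn → ℝ → ℂ) (n : ℕ) (hcont : ∀ φ, Continuous (W φ))
    (hadd : ∀ φ ψ t, W (φ + ψ) t = W φ t + W ψ t)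
    (hsmul : ∀ (c : ℂ) φ t, W (c • φ) t = c * W φ t)
    (hsupp : ∀ (φ : TestFn) (R : ℝ), (∀ t > R, φ t = 0) → ∀ t > R, W φ t = 0)
    (hbound : ∀ R > 0, ∃ c : ℝ, 0 ≤ c ∧ ∀ φ : TestFn, (∀ t > R, φ t = 0) → ∀ M : ℝ,
      (∀ t, ‖iteratedDeriv n φ t‖ ≤ M) → ∀ t ∈ Icc 0 R, ‖W φ t‖ ≤ c * M) :
    ∃ G : TestFn →L[ℂ] (E →L[ℂ] E),
      ∀ (φ : TestFn) (x : E), HasVectorIntegral (fun t => W φ t • S t x) (Ioi 0) (G φ x) := by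
  have := polynormableSpace_of_real E
  have : ContinuousSMul ℝ E := IsScalarTower.continuousSMul ℂ
  have key : ∀ (φ : TestFn) (R : ℝ), 0 < R → (∀ t > R, φ t = 0) →
      ∃ L : E →L[ℂ] E, (∀ x, HasVectorIntegral (fun t => W φ t • S t x) (Ioi 0) (L x)) ∧
      ∀ (p : Seminorm ℂ E), Continuous p → ∀ (x : E) (M : ℝ),
        (∀ t ∈ Icc 0 R, p (W φ t • S t x) ≤ M) → p (L x) ≤ R * M := by
    intro φ R hR hφ
    obtain ⟨L, hL, hp⟩ := exists_integral_clm hE hR (fun t => W φ t • S t) (fun x =>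
      (hcont φ).continuousOn.smul ((hS x).mono Icc_subset_Ici_self))
    refine ⟨L, fun x f => ?_, hp⟩
    obtain ⟨h1, h2⟩ := hL x f
    have hz : ∀ t ∈ Ioi (0 : ℝ) \ Ioc 0 R, f (W φ t • S t x) = 0 := by
      rintro t ⟨ht0, ht⟩
      rw [hsupp φ R hφ t (not_le.1 fun h => ht ⟨ht0, h⟩), zero_smul, map_zero]
    refine ⟨?_, ?_⟩
    · exact h1.of_forall_sdiff_eq_zero measurableSet_Ioi hz
    · rw [← h2]
      exact (setIntegral_eq_of_subset_of_forall_sdiff_eq_zero measurableSet_Ioi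
        Ioc_subset_Ioi_self hz)
  have hR : ∀ φ : TestFn, ∃ R : ℝ, 0 < R ∧ ∀ t > R, φ t = 0 := by
    intro φ
    obtain ⟨R, hR⟩ := φ.hasCompactSupport.isCompact.bddAbove
    refine ⟨max R 1, by positivity, fun t ht => ?_⟩
    exact image_eq_zero_of_notMem_tsupport fun h =>
      absurd (hR h) (not_le.2 ((le_max_left _ _).trans_lt ht))
  have hex : ∀ φ : TestFn, ∃ L : E →L[ℂ] E,
      ∀ x, HasVectorIntegral (fun t => W φ t • S t x) (Ioi 0) (L x) := by
    intro φ
    obtain ⟨R, h0, h⟩ := hR φ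
    obtain ⟨L, hL, -⟩ := key φ R h0 h
    exact ⟨L, hL⟩
  choose G hG using hex
  let Gl : TestFn →ₗ[ℂ] (E →L[ℂ] E) :=
    { toFun := G
      map_add' := fun φ ψ => by
        ext x
        refine (hG (φ + ψ) x).unique ?_
        simpa only [hadd, add_smul] using! (hG φ x).add (hG ψ x)
      map_smul' := fun c φ => by
        ext x
        refine (hG (c • φ) x).unique ?_
        simpa only [hsmul, mul_smul] using! (hG φ x).smul c }
  have : ContinuousSMul ℝ (E →L[ℂ] E) := IsScalarTower.continuousSMul ℂ
  refine ⟨⟨Gl, ?_⟩, hG⟩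
  -- By the inductive limit topology it suffices to treat test functions supported in a fixed
  -- compact `K`, and by linearity only continuity at `0`. Basic neighbourhoods of `0` in `L(E)`
  -- consist of the operators mapping a bounded `B` into `V`.
  refine (TestFunction.continuous_iff_continuous_comp Gl).2 fun K hK => ?_
  let i : 𝓓^{⊤}_{K}(ℝ, ℂ) →ₗ[ℂ] (E →L[ℂ] E) :=
    Gl ∘ₗ (TestFunction.ofSupportedInCLM ℂ hK : 𝓓^{⊤}_{K}(ℝ, ℂ) →L[ℂ] TestFn).toLinearMap
  change Continuous i
  refine continuous_of_continuousAt_zero i ?_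
  rw [ContinuousAt, map_zero, ContinuousLinearMap.hasBasis_nhds_zero.tendsto_right_iff]
  rintro ⟨B, V⟩ ⟨hB, hV⟩
  obtain ⟨p, hp, r, hr, hpV⟩ := exists_seminorm_ball_subset hV
  obtain ⟨R, hRK⟩ := K.isCompact.bddAbove
  obtain ⟨q, hq, hpq⟩ := exists_seminorm_bound hS (max R 1) p hp
  obtain ⟨c, hc, hcb⟩ := hbound (max R 1) (by positivity)
  obtain ⟨Q, hQ⟩ := (PolynormableSpace.withSeminorms ℂ E).isVonNBounded_iff_seminorm_bddAbove.1 hB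
    ⟨q, hq⟩
  have hQ' : ∀ x ∈ B, q x ≤ max Q 1 := fun x hx => (hQ ⟨x, hx, rfl⟩).trans (le_max_left _ _)
  have hN : Continuous (ContDiffMapSupportedIn.seminorm ℂ ℝ ℂ ⊤ K n) :=
    (ContDiffMapSupportedIn.withSeminorms ℂ ℝ ℂ ⊤ K).continuous_seminorm n
  have hlim : Tendsto (fun φ : 𝓓^{⊤}_{K}(ℝ, ℂ) =>
      max R 1 * (c * ContDiffMapSupportedIn.seminorm ℂ ℝ ℂ ⊤ K n φ * max Q 1)) (𝓝 0) (𝓝 0) := by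
    have : Continuous (fun φ : 𝓓^{⊤}_{K}(ℝ, ℂ) =>
      max R 1 * (c * ContDiffMapSupportedIn.seminorm ℂ ℝ ℂ ⊤ K n φ * max Q 1)) := by fun_prop
    simpa using this.tendsto 0
  filter_upwards [hlim.eventually_lt_const hr] with φ hφ x hx
  refine hpV _ (lt_of_le_of_lt ?_ hφ)
  have hφ0 : ∀ t > max R 1, TestFunction.ofSupportedIn hK φ t = 0 := by
    intro t ht
    refine φ.zero_on_compl fun h => ?_
    exact absurd (hRK h) (not_le.2 ((le_max_left _ _).trans_lt ht))
  obtain ⟨L, hL, hLp⟩ := key (TestFunction.ofSupportedIn hK φ) (max R 1) (by positivity) hφ0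
  -- By uniqueness of the integral, `G` does not depend on the cut-off radius, so the estimate with
  -- the radius of `K` applies.
  have e : i φ x = L x := (hG _ x).unique (hL x)
  rw [e]
  refine hLp p hp x _ fun t ht => ?_
  rw [map_smul_eq_mul]
  gcongr
  · refine hcb _ hφ0 _ (fun s => ?_) t ht
    rw [← norm_iteratedFDeriv_eq_norm_iteratedDeriv]
    exact ContDiffMapSupportedIn.norm_iteratedFDeriv_apply_le_seminorm_top ℂ (f := φ)
  · exact (hpq t ht x).trans (hQ' x hx)

end Distribution

/-! ### Right-sided fractional integrals and their semigroup law. -/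

section FractionalIntegral

/-- The kernel `g_β`, restricted to `(0, T]`. -/
def truncKer (β T : ℝ) : ℝ → ℂ := (Ioc 0 T).indicator fun y => (gFun β y : ℂ)

theorem measurable_gFun (β : ℝ) : Measurable (gFun β) := by
  unfold gFun; fun_prop

theorem measurable_truncKer (β T : ℝ) : Measurable (truncKer β T) :=
  (Complex.measurable_ofReal.comp (measurable_gFun β)).indicator measurableSet_Ioc

theorem integrableOn_gFun {β : ℝ} (hβ : 0 < β) (T : ℝ) : IntegrableOn (gFun β) (Ioc 0 T) := by
  rcases le_total T 0 with hT | hT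
  · simp [Ioc_eq_empty_of_le hT]
  have := (intervalIntegral.intervalIntegrable_rpow' (a := 0) (b := T)
    (show -1 < β - 1 by linarith)).div_const (Real.Gamma β)
  rwa [intervalIntegrable_iff_integrableOn_Ioc_of_le hT] at this

theorem integrable_truncKer {β : ℝ} (hβ : 0 < β) (T : ℝ) : Integrable (truncKer β T) := by
  rw [truncKer, integrable_indicator_iff measurableSet_Ioc]
  exact (integrableOn_gFun hβ T).ofReal

/-- Euler's beta integral, rescaled to `[0, x]`, with `B(β, γ) = Γ(β) Γ(γ) / Γ(β + γ)`. -/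
theorem gFun_mul_gFun_integral {β γ x : ℝ} (hβ : 0 < β) (hγ : 0 < γ) (hx : 0 < x) :
    ∫ y in (0 : ℝ)..x, (gFun β y : ℂ) * (gFun γ (x - y) : ℂ) = (gFun (β + γ) x : ℂ) := by
  have h1 := Complex.betaIntegral_scaled β γ hx
  have h2 := Complex.Gamma_mul_Gamma_eq_betaIntegral (s := β) (t := γ) (by simpa) (by simpa)
  have hΓ : ∀ z : ℝ, 0 < z → (Real.Gamma z : ℂ) ≠ 0 := fun z hz => by
    exact_mod_cast (Real.Gamma_pos_of_pos hz).ne'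
  have e : ∫ y in (0 : ℝ)..x, (gFun β y : ℂ) * (gFun γ (x - y) : ℂ) =
      ∫ y in (0 : ℝ)..x, ((Real.Gamma β : ℂ) * Real.Gamma γ)⁻¹ *
        ((y : ℂ) ^ ((β : ℂ) - 1) * ((x : ℂ) - y) ^ ((γ : ℂ) - 1)) := by
    refine intervalIntegral.integral_congr fun y hy => ?_
    rw [uIcc_of_le hx.le] at hy
    simp only [gFun]
    push_cast
    rw [Complex.ofReal_cpow hy.1, Complex.ofReal_cpow (sub_nonneg.2 hy.2)]
    push_cast
    have := hΓ β hβ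
    have := hΓ γ hγ
    field_simp
  rw [e, intervalIntegral.integral_const_mul, h1, gFun]
  rw [← Complex.ofReal_add, Complex.Gamma_ofReal, Complex.Gamma_ofReal, Complex.Gamma_ofReal] at h2
  push_cast
  rw [Complex.ofReal_cpow hx.le]
  push_cast
  have h3 := hΓ β hβ
  have h4 := hΓ γ hγ
  have h5 := hΓ (β + γ) (by linarith)
  rw [h2]
  have h6 : Complex.betaIntegral β γ ≠ 0 := by
    intro h
    rw [h, mul_zero] at h2
    exact mul_ne_zero h3 h4 h2
  field_simp

theorem truncKer_conv {β γ x T : ℝ} (hβ : 0 < β) (hγ : 0 < γ) (hx : 0 < x) (hT : x ≤ T) :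
    ∫ y, truncKer β T y * truncKer γ T (x - y) = (gFun (β + γ) x : ℂ) := by
  rw [← gFun_mul_gFun_integral hβ hγ hx, intervalIntegral.integral_of_le hx.le,
    integral_Ioc_eq_integral_Ioo, ← integral_indicator measurableSet_Ioo]
  congr 1
  funext y
  by_cases hy : y ∈ Ioo 0 x
  · have h1 : y ∈ Ioc 0 T := ⟨hy.1, hy.2.le.trans hT⟩
    have h2 : x - y ∈ Ioc 0 T := ⟨by linarith [hy.2], by linarith [hy.1]⟩
    simp [truncKer, hy, h1, h2]
  · rw [indicator_of_notMem hy]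
    by_cases h1 : 0 < y
    · have h2 : x - y ∉ Ioc 0 T := fun h => hy ⟨h1, by linarith [h.1]⟩
      simp [truncKer, h2]
    · have h2 : y ∉ Ioc 0 T := fun h => h1 h.1
      simp [truncKer, h2]

/-- The right-sided fractional integral `∫_t^∞ g_β(s - t) h(s) ds` of order `β ≥ 0`. -/
def fracInt (β : ℝ) (h : ℝ → ℂ) (t : ℝ) : ℂ :=
  if β = 0 then h t else ∫ s in Ioi t, (gFun β (s - t) : ℂ) * h s

theorem fracInt_zero (h : ℝ → ℂ) : fracInt 0 h = h := by
  funext t; simp [fracInt]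

theorem fracInt_of_pos {β : ℝ} (hβ : 0 < β) (h : ℝ → ℂ) (t : ℝ) :
    fracInt β h t = ∫ s in Ioi t, (gFun β (s - t) : ℂ) * h s := by
  simp [fracInt, hβ.ne']

/-- Since `h` vanishes beyond `R`, only kernel arguments in `(0, R - t]` matter. The truncated
kernel is integrable on `ℝ`, which makes Fubini and `L¹` estimates available. -/
theorem fracInt_eq_truncKer {β : ℝ} (hβ : 0 < β) {h : ℝ → ℂ} {t R T : ℝ}
    (hR : ∀ s > R, h s = 0) (hT : R - t ≤ T) :
    fracInt β h t = ∫ s, truncKer β T (s - t) * h s := by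
  rw [fracInt_of_pos hβ, ← integral_indicator measurableSet_Ioi]
  congr 1
  funext s
  by_cases hs : t < s
  · by_cases hsR : R < s
    · simp [hR s hsR]
    · have : s - t ∈ Ioc 0 T := ⟨by linarith, by linarith⟩
      simp [truncKer, hs, this]
  · have : s - t ∉ Ioc 0 T := fun h => hs (by linarith [h.1])
    simp [truncKer, hs, this]

theorem fracInt_congr {β : ℝ} {h h' : ℝ → ℂ} {t : ℝ} (hh : ∀ s ≥ t, h s = h' s) :
    fracInt β h t = fracInt β h' t := by
  unfold fracInt
  split_ifs
  · exact hh t le_rfl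
  · refine setIntegral_congr_fun measurableSet_Ioi fun s hs => ?_
    simp only [hh s (le_of_lt hs)]

theorem fracInt_eq_zero {β : ℝ} {h : ℝ → ℂ} {R : ℝ} (hR : ∀ s > R, h s = 0) {t : ℝ} (ht : R < t) :
    fracInt β h t = 0 := by
  rw [fracInt_congr (h' := fun _ => 0) fun s hs => hR s (lt_of_lt_of_le ht hs)]
  simp [fracInt]

theorem fracInt_const_mul (β : ℝ) (c : ℂ) (h : ℝ → ℂ) (t : ℝ) :
    fracInt β (fun s => c * h s) t = c * fracInt β h t := by
  unfold fracInt
  split_ifs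
  · rfl
  · rw [← integral_const_mul]
    congr 1
    funext s
    ring

theorem integrable_truncKer_sub_mul {β : ℝ} (hβ : 0 < β) (T t : ℝ) {h : ℝ → ℂ}
    (hm : Measurable h) {M : ℝ} (hM : ∀ s > t, ‖h s‖ ≤ M) :
    Integrable fun s => truncKer β T (s - t) * h s := by
  have h1 : Integrable fun s => truncKer β T (s - t) * (Ioi t).indicator h s := by
    refine ((integrable_truncKer hβ T).comp_sub_right t).mul_bdd (c := max M 0)
      (hm.indicator measurableSet_Ioi).aestronglyMeasurable (Eventually.of_forall fun s => ?_)
    by_cases hs : t < s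
    · simpa [hs] using Or.inl (hM s hs)
    · simp [hs]
  refine h1.congr (Eventually.of_forall fun s => ?_)
  by_cases hs : t < s
  · simp [hs]
  · have : s - t ∉ Ioc 0 T := fun h => hs (by linarith [h.1])
    simp [truncKer, this]

theorem fracInt_add {β : ℝ} (hβ : 0 ≤ β) {h k : ℝ → ℂ} {t R M : ℝ}
    (hhm : Measurable h) (hhb : ∀ s > t, ‖h s‖ ≤ M) (hhR : ∀ s > R, h s = 0)
    (hkm : Measurable k) (hkb : ∀ s > t, ‖k s‖ ≤ M) (hkR : ∀ s > R, k s = 0) :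
    fracInt β (fun s => h s + k s) t = fracInt β h t + fracInt β k t := by
  rcases hβ.eq_or_lt with rfl | hβ
  · simp [fracInt]
  rw [fracInt_eq_truncKer hβ (R := R) (fun s hs => by rw [hhR s hs, hkR s hs, add_zero]) le_rfl,
    fracInt_eq_truncKer hβ hhR le_rfl, fracInt_eq_truncKer hβ hkR le_rfl, ← integral_add
      (integrable_truncKer_sub_mul hβ _ _ hhm hhb) (integrable_truncKer_sub_mul hβ _ _ hkm hkb)]
  simp only [mul_add]

theorem norm_fracInt_le {β : ℝ} (hβ : 0 < β) {h : ℝ → ℂ} {t R T M : ℝ}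
    (hhb : ∀ s > t, ‖h s‖ ≤ M) (hhR : ∀ s > R, h s = 0) (hT : R - t ≤ T) :
    ‖fracInt β h t‖ ≤ (∫ y, ‖truncKer β T y‖) * M := by
  rw [fracInt_eq_truncKer hβ hhR hT,
    ← integral_sub_right_eq_self (fun y => ‖truncKer β T y‖) t, ← integral_mul_const]
  refine norm_integral_le_of_norm_le
    (((integrable_truncKer hβ T).norm.comp_sub_right t).mul_const M)
    (Eventually.of_forall fun s => ?_)
  rw [norm_mul]
  by_cases hs : t < s
  · gcongr
    exact hhb s hs
  · have : s - t ∉ Ioc 0 T := fun h => hs (by linarith [h.1])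
    simp [truncKer, this]

theorem fracInt_fracInt {β γ : ℝ} (hβ : 0 ≤ β) (hγ : 0 ≤ γ) {h : ℝ → ℂ} {t R M : ℝ}
    (hm : Measurable h) (hM : ∀ s > t, ‖h s‖ ≤ M) (hR : ∀ s > R, h s = 0) :
    fracInt β (fracInt γ h) t = fracInt (β + γ) h t := by
  rcases hβ.eq_or_lt with rfl | hβ
  · rw [fracInt_zero, zero_add]
  rcases hγ.eq_or_lt with rfl | hγ
  · rw [fracInt_zero, add_zero]
  set T := R - t
  -- The bound on `h` is only known to the right of `t`; cutting off there changes neither side and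
  -- gives a globally bounded factor for Fubini.
  set h' := (Ioi t).indicator h with hh'
  have hm' : Measurable h' := hm.indicator measurableSet_Ioi
  have hM' : ∀ s, ‖h' s‖ ≤ max M 0 := fun s => by
    by_cases hs : t < s
    · simpa [h', hs] using Or.inl (hM s hs)
    · simp [h', hs]
  have hR' : ∀ s > R, h' s = 0 := fun s hs => by simp [h', indicator, hR s hs]
  have e1 : fracInt β (fracInt γ h) t =
      ∫ s, ∫ r, truncKer β T (s - t) * truncKer γ T (r - s) * h' r := by
    rw [fracInt_eq_truncKer hβ (R := R) (fun s hs => fracInt_eq_zero hR hs) le_rfl]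
    congr 1
    funext s
    simp only [mul_assoc]
    rw [integral_const_mul]
    by_cases hs : t < s
    · rw [← fracInt_eq_truncKer hγ hR' (show R - s ≤ T by simp only [T]; linarith)]
      congr 1
      refine fracInt_congr fun r hr => ?_
      simp [h', lt_of_lt_of_le hs hr]
    · have : s - t ∉ Ioc 0 T := fun h => hs (by linarith [h.1])
      rw [show truncKer β T (s - t) = 0 from indicator_of_notMem this _, zero_mul, zero_mul]
  have hint : Integrable (Function.uncurry fun s r =>
      truncKer β T (s - t) * truncKer γ T (r - s) * h' r) (volume.prod volume) := by
    have h1 := (Integrable.convolution_integrand (ContinuousLinearMap.mul ℝ ℂ)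
      ((integrable_truncKer hβ T).comp_sub_right t) (integrable_truncKer hγ T)).swap
    exact h1.mul_bdd (c := max M 0) (hm'.comp measurable_snd).aestronglyMeasurable
      (Eventually.of_forall fun p => hM' p.2)
  rw [e1, integral_integral_swap hint, fracInt_of_pos (by linarith),
    ← integral_indicator measurableSet_Ioi]
  congr 1
  funext r
  rw [integral_mul_const]
  by_cases hr : t < r
  · by_cases hrR : R < r
    · simp [hR' r hrR, indicator, hR r hrR]
    · have : ∫ s, truncKer β T (s - t) * truncKer γ T (r - s) = (gFun (β + γ) (r - t) : ℂ) := by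
        rw [← truncKer_conv hβ hγ (T := T) (x := r - t) (by linarith) (by simp only [T]; linarith),
          ← integral_sub_right_eq_self
            (fun y => truncKer β T y * truncKer γ T (r - t - y)) t]
        simp only [sub_sub_sub_cancel_right]
      rw [this]
      simp [h', hr]
  · simp [h', hr]

end FractionalIntegral

/-! ### The Weyl derivative as a fractional integral of a classical derivative. -/

section WeylDerivative

/-- With a locally integrable kernel on the left, continuity and differentiation pass to the
compactly supported factor `f`. -/
theorem fracInt_eq_convolution {β : ℝ} (hβ : 0 < β) (f : ℝ → ℂ) :
    fracInt β f = ((Iio (0 : ℝ)).indicator fun s => (gFun β (-s) : ℂ))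
      ⋆[ContinuousLinearMap.mul ℝ ℂ, volume] f := by
  funext t
  rw [fracInt_of_pos hβ, convolution_def, ← integral_indicator measurableSet_Ioi,
    ← integral_sub_left_eq_self _ volume t]
  congr 1
  funext s
  by_cases hs : s < 0
  · have : t < t - s := by linarith
    simp [hs, this]
  · have : ¬t < t - s := by linarith
    simp [hs, this]

theorem locallyIntegrable_reflected_gFun {β : ℝ} (hβ : 0 < β) :
    LocallyIntegrable ((Iio (0 : ℝ)).indicator fun s => (gFun β (-s) : ℂ)) := by
  rw [locallyIntegrable_iff]
  intro K hK
  obtain ⟨T, hT⟩ := hK.bddBelow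
  have h1 : Integrable fun s => truncKer β (-T) (-s) := (integrable_truncKer hβ _).comp_neg
  refine (h1.integrableOn (s := K)).congr_fun_ae ?_
  refine (ae_restrict_iff' hK.measurableSet).2 (Eventually.of_forall fun s hs => ?_)
  have h2 : T ≤ s := hT hs
  by_cases h : s < 0
  · simp [truncKer, h, h2]
  · simp [truncKer, h]

theorem hasDerivAt_fracInt {β : ℝ} (hβ : 0 < β) {f : ℝ → ℂ} (hf : ContDiff ℝ 1 f)
    (hc : HasCompactSupport f) (t : ℝ) :
    HasDerivAt (fracInt β f) (fracInt β (deriv f) t) t := by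
  rw [fracInt_eq_convolution hβ, fracInt_eq_convolution hβ]
  exact hc.hasDerivAt_convolution_right _ (locallyIntegrable_reflected_gFun hβ) hf t

theorem continuous_fracInt {β : ℝ} (hβ : 0 ≤ β) {f : ℝ → ℂ} (hf : Continuous f)
    (hc : HasCompactSupport f) : Continuous (fracInt β f) := by
  rcases hβ.eq_or_lt with rfl | hβ
  · rwa [fracInt_zero]
  rw [fracInt_eq_convolution hβ]
  exact hc.continuous_convolution_right _ (locallyIntegrable_reflected_gFun hβ) hf

theorem hasCompactSupport_iteratedDeriv {f : ℝ → ℂ} (hc : HasCompactSupport f) (n : ℕ) :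
    HasCompactSupport (iteratedDeriv n f) := by
  induction n with
  | zero => simpa using hc
  | succ n ih => rw [iteratedDeriv_succ]; exact ih.deriv

theorem contDiff_iteratedDeriv {f : ℝ → ℂ} (hf : ContDiff ℝ ∞ f) (n : ℕ) :
    ContDiff ℝ ∞ (iteratedDeriv n f) := by
  induction n with
  | zero => simpa using hf
  | succ n ih => rw [iteratedDeriv_succ]; exact (contDiff_infty_iff_deriv.1 ih).2

theorem iteratedDeriv_fracInt {β : ℝ} (hβ : 0 < β) {f : ℝ → ℂ} (hf : ContDiff ℝ ∞ f)
    (hc : HasCompactSupport f) (n : ℕ) :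
    iteratedDeriv n (fracInt β f) = fracInt β (iteratedDeriv n f) := by
  induction n with
  | zero => simp
  | succ n ih =>
    rw [iteratedDeriv_succ, ih, iteratedDeriv_succ]
    funext t
    exact (hasDerivAt_fracInt hβ ((contDiff_iteratedDeriv hf n).of_le (by simp))
      (hasCompactSupport_iteratedDeriv hc n) t).deriv

theorem iteratedDeriv_eq_zero_of_gt {f : ℝ → ℂ} {R : ℝ} (hR : ∀ t > R, f t = 0) (n : ℕ) :
    ∀ t > R, iteratedDeriv n f t = 0 := by
  intro t ht
  have : f =ᶠ[𝓝 t] fun _ => 0 := by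
    filter_upwards [lt_mem_nhds ht] with s hs using hR s hs
  rw [this.iteratedDeriv_eq]
  simp

theorem exists_norm_le_of_hasCompactSupport {f : ℝ → ℂ} (hf : Continuous f)
    (hc : HasCompactSupport f) : ∃ M, ∀ t, ‖f t‖ ≤ M :=
  hf.bounded_above_of_compact_support hc

theorem exists_eq_zero_of_hasCompactSupport {f : ℝ → ℂ} (hc : HasCompactSupport f) :
    ∃ R : ℝ, 0 < R ∧ ∀ t > R, f t = 0 := by
  obtain ⟨R, hR⟩ := hc.isCompact.bddAbove
  refine ⟨max R 1, by positivity, fun t ht => ?_⟩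
  exact image_eq_zero_of_notMem_tsupport fun h =>
    absurd (hR h) (not_le.2 ((le_max_left _ _).trans_lt ht))

/-- Moving the `n` derivatives under the integral gives one formula for all orders, with `fracInt 0`
the identity in the integer case. -/
theorem weylDeriv_eq_fracInt {α : ℝ} {f : ℝ → ℂ} (hf : ContDiff ℝ ∞ f)
    (hc : HasCompactSupport f) (t : ℝ) :
    weylDeriv α f t = (-1) ^ ⌈α⌉₊ * fracInt (⌈α⌉₊ - α) (iteratedDeriv ⌈α⌉₊ f) t := by
  unfold weylDeriv
  split_ifs with h
  · rw [← h, sub_self, fracInt_zero]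
  · have hβ : 0 < (⌈α⌉₊ : ℝ) - α := sub_pos.2 (lt_of_le_of_ne (Nat.le_ceil α) h)
    have hΓ : (Real.Gamma (⌈α⌉₊ - α) : ℂ) ≠ 0 := by
      exact_mod_cast (Real.Gamma_pos_of_pos hβ).ne'
    have e : (fun r => ∫ s in Ioi r, (((s - r) ^ ((⌈α⌉₊ : ℝ) - α - 1) : ℝ) : ℂ) * f s) =
        fun r => (Real.Gamma (⌈α⌉₊ - α) : ℂ) * fracInt (⌈α⌉₊ - α) f r := by
      funext r
      rw [fracInt_of_pos hβ, ← integral_const_mul]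
      congr 1
      funext s
      simp only [gFun]
      push_cast
      field_simp
    rw [e, iteratedDeriv_const_mul_field, iteratedDeriv_fracInt hβ hf hc]
    field_simp

theorem ceil_sub_nonneg (α : ℝ) : 0 ≤ (⌈α⌉₊ : ℝ) - α := sub_nonneg.2 (Nat.le_ceil α)

theorem continuous_weylDeriv (α : ℝ) {f : ℝ → ℂ} (hf : ContDiff ℝ ∞ f)
    (hc : HasCompactSupport f) : Continuous (weylDeriv α f) := by
  rw [show weylDeriv α f = _ from funext (weylDeriv_eq_fracInt hf hc)]
  exact continuous_const.mul (continuous_fracInt (ceil_sub_nonneg α)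
    (contDiff_iteratedDeriv hf _).continuous (hasCompactSupport_iteratedDeriv hc _))

theorem weylDeriv_eq_zero (α : ℝ) {f : ℝ → ℂ} (hf : ContDiff ℝ ∞ f)
    (hc : HasCompactSupport f) {R : ℝ} (hR : ∀ t > R, f t = 0) : ∀ t > R, weylDeriv α f t = 0 := by
  intro t ht
  rw [weylDeriv_eq_fracInt hf hc,
    fracInt_eq_zero (iteratedDeriv_eq_zero_of_gt hR _) ht, mul_zero]

theorem weylDeriv_add (α : ℝ) {f g : ℝ → ℂ} (hf : ContDiff ℝ ∞ f)
    (hfc : HasCompactSupport f) (hg : ContDiff ℝ ∞ g) (hgc : HasCompactSupport g) (t : ℝ) :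
    weylDeriv α (fun s => f s + g s) t = weylDeriv α f t + weylDeriv α g t := by
  set n := ⌈α⌉₊
  obtain ⟨M, hM⟩ := exists_norm_le_of_hasCompactSupport (contDiff_iteratedDeriv hf n).continuous
    (hasCompactSupport_iteratedDeriv hfc n)
  obtain ⟨M', hM'⟩ := exists_norm_le_of_hasCompactSupport (contDiff_iteratedDeriv hg n).continuous
    (hasCompactSupport_iteratedDeriv hgc n)
  obtain ⟨R, -, hR⟩ := exists_eq_zero_of_hasCompactSupport (hasCompactSupport_iteratedDeriv hfc n)
  obtain ⟨R', -, hR'⟩ := exists_eq_zero_of_hasCompactSupport (hasCompactSupport_iteratedDeriv hgc n)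
  rw [weylDeriv_eq_fracInt (hf.add hg) (hfc.add hgc), weylDeriv_eq_fracInt hf hfc,
    weylDeriv_eq_fracInt hg hgc, ← mul_add, ← fracInt_add (R := max R R') (M := max M M')
      (ceil_sub_nonneg α) (contDiff_iteratedDeriv hf n).continuous.measurable
      (fun s _ => (hM s).trans (le_max_left _ _))
      (fun s hs => hR s ((le_max_left _ _).trans_lt hs))
      (contDiff_iteratedDeriv hg n).continuous.measurable
      (fun s _ => (hM' s).trans (le_max_right _ _))
      (fun s hs => hR' s ((le_max_right _ _).trans_lt hs))]
  congr 1
  refine fracInt_congr fun s _ => ?_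
  exact iteratedDeriv_add (contDiff_infty.1 hf _).contDiffAt
    (contDiff_infty.1 hg _).contDiffAt

theorem weylDeriv_const_mul (α : ℝ) (c : ℂ) {f : ℝ → ℂ} (hf : ContDiff ℝ ∞ f)
    (hc : HasCompactSupport f) (t : ℝ) :
    weylDeriv α (fun s => c * f s) t = c * weylDeriv α f t := by
  rw [weylDeriv_eq_fracInt (contDiff_const.mul hf) hc.mul_left, weylDeriv_eq_fracInt hf hc,
    show iteratedDeriv ⌈α⌉₊ (fun s => c * f s) = fun s => c * iteratedDeriv ⌈α⌉₊ f s from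
      funext fun s => iteratedDeriv_const_mul_field c f, fracInt_const_mul]
  ring

theorem exists_norm_weylDeriv_le (α R : ℝ) : ∃ c : ℝ, 0 ≤ c ∧ ∀ f : ℝ → ℂ,
    ContDiff ℝ ∞ f → HasCompactSupport f → (∀ t > R, f t = 0) → ∀ M : ℝ,
      (∀ t, ‖iteratedDeriv ⌈α⌉₊ f t‖ ≤ M) → ∀ t ≥ 0, ‖weylDeriv α f t‖ ≤ c * M := by
  rcases (ceil_sub_nonneg α).eq_or_lt with h | h
  · refine ⟨1, zero_le_one, fun f hf hc hR M hM t ht => ?_⟩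
    rw [weylDeriv_eq_fracInt hf hc, ← h, fracInt_zero]
    simpa using hM t
  -- For `t ≥ 0` only kernel arguments up to `R - t ≤ R` occur, so the `L¹` norm of the kernel on
  -- `(0, R]` serves for all `t`.
  · refine ⟨∫ y, ‖truncKer (⌈α⌉₊ - α) R y‖, by positivity, fun f hf hc hR M hM t ht => ?_⟩
    rw [weylDeriv_eq_fracInt hf hc, norm_mul]
    have := norm_fracInt_le h (t := t) (R := R) (T := R) (fun s _ => hM s)
      (iteratedDeriv_eq_zero_of_gt hR _) (by linarith)
    simpa using this

theorem gFun_one (t : ℝ) : gFun 1 t = 1 := by simp [gFun]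

theorem fracInt_one (h : ℝ → ℂ) (t : ℝ) : fracInt 1 h t = ∫ s in Ioi t, h s := by
  rw [fracInt_of_pos one_pos]
  simp [gFun_one]

theorem fracInt_one_deriv {f : ℝ → ℂ} (hf : ContDiff ℝ ∞ f) (hc : HasCompactSupport f) (t : ℝ) :
    fracInt 1 (deriv f) t = -f t := by
  rw [fracInt_one]
  exact hc.integral_Ioi_deriv_eq (hf.of_le (by simp)) t

theorem fracInt_comp_of_hasCompactSupport {β γ : ℝ} (hβ : 0 ≤ β) (hγ : 0 ≤ γ) {f : ℝ → ℂ}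
    (hf : Continuous f) (hc : HasCompactSupport f) :
    fracInt β (fracInt γ f) = fracInt (β + γ) f := by
  obtain ⟨M, hM⟩ := exists_norm_le_of_hasCompactSupport hf hc
  obtain ⟨R, -, hR⟩ := exists_eq_zero_of_hasCompactSupport hc
  exact funext fun t => fracInt_fracInt hβ hγ hf.measurable (fun s _ => hM s) hR

theorem fracInt_iteratedDeriv {f : ℝ → ℂ} (hf : ContDiff ℝ ∞ f) (hc : HasCompactSupport f)
    (n : ℕ) (t : ℝ) : fracInt n (iteratedDeriv n f) t = (-1) ^ n * f t := by
  induction n generalizing t with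
  | zero => simp [fracInt_zero]
  | succ n ih =>
    have h1 := contDiff_iteratedDeriv hf n
    have h2 := hasCompactSupport_iteratedDeriv hc n
    push_cast
    rw [iteratedDeriv_succ, ← fracInt_comp_of_hasCompactSupport n.cast_nonneg zero_le_one
      (contDiff_infty_iff_deriv.1 h1).2.continuous h2.deriv,
      fracInt_congr (h' := fun s => (-1) * iteratedDeriv n f s)
        (fun s _ => by rw [fracInt_one_deriv h1 h2]; ring), fracInt_const_mul, ih]
    ring

/-- The fractional integral of order `α` inverts the Weyl derivative of order `α`. -/
theorem fracInt_weylDeriv {α : ℝ} (hα : 0 ≤ α) {f : ℝ → ℂ} (hf : ContDiff ℝ ∞ f)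
    (hc : HasCompactSupport f) (t : ℝ) : fracInt α (weylDeriv α f) t = f t := by
  rw [show weylDeriv α f = _ from funext (weylDeriv_eq_fracInt hf hc), fracInt_const_mul,
    fracInt_comp_of_hasCompactSupport hα (ceil_sub_nonneg α)
      (contDiff_iteratedDeriv hf _).continuous (hasCompactSupport_iteratedDeriv hc _),
    add_sub_cancel, fracInt_iteratedDeriv hf hc, ← mul_assoc, ← mul_pow]
  simp

/-- `∫_t^∞ W^α f' = -W^α f`. -/
theorem fracInt_one_weylDeriv_deriv (α : ℝ) {f : ℝ → ℂ} (hf : ContDiff ℝ ∞ f)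
    (hc : HasCompactSupport f) (t : ℝ) :
    fracInt 1 (weylDeriv α (deriv f)) t = -weylDeriv α f t := by
  have hf' := (contDiff_infty_iff_deriv.1 hf).2
  have h1 := contDiff_iteratedDeriv hf ⌈α⌉₊
  have h2 := hasCompactSupport_iteratedDeriv hc ⌈α⌉₊
  have h3 : iteratedDeriv ⌈α⌉₊ (deriv f) = deriv (iteratedDeriv ⌈α⌉₊ f) := by
    rw [← iteratedDeriv_succ, iteratedDeriv_succ']
  have h4 := (contDiff_infty_iff_deriv.1 h1).2.continuous
  -- `I^1` and `I^(n-α)` commute, so `I^1` can act directly on the derivative of `f⁽ⁿ⁾`.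
  rw [show weylDeriv α (deriv f) = _ from funext (weylDeriv_eq_fracInt hf' hc.deriv),
    fracInt_const_mul, h3, fracInt_comp_of_hasCompactSupport zero_le_one (ceil_sub_nonneg α) h4
      h2.deriv, add_comm, ← fracInt_comp_of_hasCompactSupport (ceil_sub_nonneg α) zero_le_one h4
      h2.deriv, fracInt_congr (h' := fun s => (-1) * iteratedDeriv ⌈α⌉₊ f s)
        (fun s _ => by rw [fracInt_one_deriv h1 h2]; ring), fracInt_const_mul,
        weylDeriv_eq_fracInt hf hc]
  ring

end WeylDerivative

/-! ### Injectivity of fractional integration. -/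

section Injectivity

/-- For positive order the value at the endpoint `t` is irrelevant. This covers `t = 0` for
functions cut off to the open half-line. -/
theorem fracInt_congr_of_pos {β : ℝ} (hβ : 0 < β) {h h' : ℝ → ℂ} {t : ℝ}
    (hh : ∀ s > t, h s = h' s) : fracInt β h t = fracInt β h' t := by
  rw [fracInt_of_pos hβ, fracInt_of_pos hβ]
  exact setIntegral_congr_fun measurableSet_Ioi fun s hs => by simp only [hh s hs]

theorem integrable_indicator_of_bounded {h : ℝ → ℂ} {R M : ℝ} (hm : Measurable h)
    (hM : ∀ s > 0, ‖h s‖ ≤ M) (hR : ∀ s > R, h s = 0) : Integrable ((Ioi (0 : ℝ)).indicator h) := by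
  have h1 : Integrable ((Ioc (0 : ℝ) R).indicator fun _ => M) :=
    (integrable_indicator_iff measurableSet_Ioc).2 (by simp)
  refine h1.mono' (hm.indicator measurableSet_Ioi).aestronglyMeasurable
    (Eventually.of_forall fun s => ?_)
  by_cases hs : 0 < s
  · by_cases hs' : s ≤ R
    · simpa [hs, hs'] using hM s hs
    · simp [hR s (not_le.1 hs'), indicator, hs']
  · simp [hs]

theorem ae_eq_zero_of_fracInt_one_eq_zero {h : ℝ → ℂ} {R M : ℝ} (hm : Measurable h)
    (hM : ∀ s > 0, ‖h s‖ ≤ M) (hR : ∀ s > R, h s = 0) (h0 : ∀ t > 0, fracInt 1 h t = 0) :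
    ∀ᵐ t ∂volume.restrict (Ioi 0), h t = 0 := by
  have hi := integrable_indicator_of_bounded hm hM hR
  set h' := (Ioi (0 : ℝ)).indicator h with hh'
  have hz : ∀ x > 0, ∫ s in (1 : ℝ)..x, h' s = 0 := by
    intro x hx
    have h2 : ∀ t > 0, ∫ s in Ioi t, h' s = 0 := fun t ht => by
      rw [← h0 t ht, fracInt_one]
      refine setIntegral_congr_fun measurableSet_Ioi fun s hs => ?_
      simp [h', lt_trans ht hs]
    rw [← intervalIntegral.integral_Ioi_sub_Ioi' hi.integrableOn hi.integrableOn,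
      h2 1 one_pos, h2 x hx, sub_zero]
  refine (ae_restrict_iff' measurableSet_Ioi).2 ?_
  -- Lebesgue differentiation: `h'` is almost everywhere the derivative of its primitive, which is
  -- zero on `(0, ∞)`.
  filter_upwards [LocallyIntegrable.ae_hasDerivAt_integral hi.locallyIntegrable] with x hx hx0
  have h3 : (fun y => ∫ s in (1 : ℝ)..y, h' s) =ᶠ[𝓝 x] fun _ => 0 := by
    filter_upwards [lt_mem_nhds hx0] with y hy using hz y hy
  have h4 := ((hx 1).congr_of_eventuallyEq h3.symm).unique (hasDerivAt_const x (0 : ℂ))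
  simpa [h', mem_Ioi.1 hx0] using h4

theorem continuous_fracInt_one {h : ℝ → ℂ} (hi : Integrable h) : Continuous (fracInt 1 h) := by
  have : fracInt 1 h = fun t => (∫ s in Ioi (0 : ℝ), h s) - ∫ s in (0 : ℝ)..t, h s := by
    funext t
    rw [fracInt_one, ← intervalIntegral.integral_Ioi_sub_Ioi' hi.integrableOn hi.integrableOn]
    ring
  rw [this]
  exact continuous_const.sub (intervalIntegral.continuous_primitive
    (fun a b => hi.intervalIntegrable) 0)

theorem ae_eq_zero_of_fracInt_nat_eq_zero (n : ℕ) {h : ℝ → ℂ} {R M : ℝ} (hm : Measurable h)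
    (hM : ∀ s > 0, ‖h s‖ ≤ M) (hR : ∀ s > R, h s = 0)
    (h0 : ∀ t > 0, fracInt (n + 1 : ℕ) h t = 0) :
    ∀ᵐ t ∂volume.restrict (Ioi 0), h t = 0 := by
  induction n generalizing h M with
  | zero => exact ae_eq_zero_of_fracInt_one_eq_zero hm hM hR (by simpa using h0)
  | succ n ih =>
    have hi := integrable_indicator_of_bounded hm hM hR
    set h' := (Ioi (0 : ℝ)).indicator h with hh'
    have hc := continuous_fracInt_one hi
    have e : ∀ t > 0, fracInt 1 h' t = fracInt 1 h t := fun t ht =>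
      fracInt_congr fun s hs => by simp [h', lt_of_lt_of_le ht hs]
    have hR' : ∀ s > R, h' s = 0 := fun s hs => by simp [h', indicator, hR s hs]
    have hb : ∀ t > 0, ‖fracInt 1 h' t‖ ≤ ∫ s, ‖h' s‖ := by
      intro t ht
      rw [fracInt_one]
      refine (norm_integral_le_integral_norm _).trans ?_
      exact setIntegral_le_integral hi.norm (Eventually.of_forall fun s => norm_nonneg _)
    have h1 : ∀ t > 0, fracInt (n + 1 : ℕ) (fracInt 1 h') t = 0 := by
      intro t ht
      rw [← h0 t ht, fracInt_congr (h' := fracInt 1 h) fun s hs => e s (lt_of_lt_of_le ht hs),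
        fracInt_fracInt (Nat.cast_nonneg _) zero_le_one hm (fun s hs => hM s (ht.trans hs)) hR]
      push_cast
      rfl
    have h2 := ih hc.measurable hb (fun s hs => fracInt_eq_zero hR' hs) h1
    -- The induction hypothesis gives vanishing almost everywhere only; continuity of `I^1 h'` makes
    -- it hold everywhere.
    have h3 : EqOn (fracInt 1 h') (fun _ => 0) (Ioi 0) :=
      Measure.eqOn_open_of_ae_eq h2 isOpen_Ioi hc.continuousOn continuousOn_const
    exact ae_eq_zero_of_fracInt_one_eq_zero hm hM hR fun t ht => (e t ht).symm.trans (h3 ht)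

/-- Fractional integration is injective. -/
theorem ae_eq_zero_of_fracInt_eq_zero {α : ℝ} (hα : 0 < α) {h : ℝ → ℂ} {R M : ℝ}
    (hm : Measurable h) (hM : ∀ s > 0, ‖h s‖ ≤ M) (hR : ∀ s > R, h s = 0)
    (h0 : ∀ t > 0, fracInt α h t = 0) :
    ∀ᵐ t ∂volume.restrict (Ioi 0), h t = 0 := by
  obtain ⟨n, hn⟩ := Nat.exists_eq_succ_of_ne_zero (Nat.ceil_pos.2 hα).ne'
  refine ae_eq_zero_of_fracInt_nat_eq_zero n hm hM hR fun t ht => ?_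
  -- Applying `I^(⌈α⌉ - α)` to `I^α h = 0` raises the order to the integer `⌈α⌉`.
  rw [← Nat.succ_eq_add_one, ← hn, show (⌈α⌉₊ : ℝ) = (⌈α⌉₊ - α) + α by ring,
    ← fracInt_fracInt (ceil_sub_nonneg α) hα.le hm (fun s hs => hM s (ht.trans hs)) hR,
    fracInt_congr (h' := fun _ => 0) fun s hs => h0 s (lt_of_lt_of_le ht hs)]
  simp [fracInt]

end Injectivity

/-! ### The kernel of a product of two integrals against `S`. -/

section ProductKernel

/-- The sign pattern of `∫_0^{t+s} - ∫_0^t - ∫_0^s`. -/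
def signFun (p : ℝ × ℝ) (r : ℝ) : ℂ :=
  1 - (Ioi r).indicator 1 p.1 - (Ioi r).indicator 1 p.2

theorem measurable_signFun : Measurable fun q : (ℝ × ℝ) × ℝ => signFun q.1 q.2 := by
  have h : ∀ c : ℝ × ℝ → ℝ, Measurable c →
      Measurable fun q : (ℝ × ℝ) × ℝ => (Ioi q.2).indicator (1 : ℝ → ℂ) (c q.1) := by
    intro c hc
    have : (fun q : (ℝ × ℝ) × ℝ => (Ioi q.2).indicator (1 : ℝ → ℂ) (c q.1)) =
        {q : (ℝ × ℝ) × ℝ | q.2 < c q.1}.indicator 1 := by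
      funext q
      simp [indicator]
    rw [this]
    exact measurable_one.indicator (measurableSet_lt measurable_snd (hc.comp measurable_fst))
  exact (measurable_const.sub (h _ measurable_fst)).sub (h _ measurable_snd)

theorem norm_signFun_le (p : ℝ × ℝ) (r : ℝ) : ‖signFun p r‖ ≤ 3 := by
  have h : ∀ x : ℝ, ‖(Ioi r).indicator (1 : ℝ → ℂ) x‖ ≤ 1 := fun x => by
    by_cases hx : r < x <;> simp [hx]
  calc ‖signFun p r‖ ≤ ‖(1 : ℂ)‖ + ‖(Ioi r).indicator (1 : ℝ → ℂ) p.1‖ +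
        ‖(Ioi r).indicator (1 : ℝ → ℂ) p.2‖ :=
        (norm_sub_le _ _).trans (add_le_add_left (norm_sub_le _ _) _)
    _ ≤ 1 + 1 + 1 := by gcongr <;> simp [h]
    _ = 3 := by norm_num

theorem integrable_prod_of_bound {X : Type*} [MeasurableSpace X] {μ : Measure X} [SFinite μ]
    {ν : Measure ℝ} [SFinite ν] {K : X × ℝ → ℂ} (hK : Measurable K) {w : ℝ → ℝ}
    (hw : Integrable w ν) (h1 : ∀ r, Integrable (fun p => K (p, r)) μ)
    (h2 : ∀ r, ∫ p, ‖K (p, r)‖ ∂μ ≤ w r) : Integrable K (μ.prod ν) := by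
  refine (integrable_prod_iff' hK.aestronglyMeasurable).2 ⟨Eventually.of_forall h1, ?_⟩
  refine hw.mono' ?_ (Eventually.of_forall fun r => ?_)
  · exact (hK.norm.stronglyMeasurable.integral_prod_left').aestronglyMeasurable
  · rw [Real.norm_of_nonneg (by positivity)]
    exact h2 r

/-- `∬ U(t) V(s) g(t + s - r) [1_{r < t + s} - 1_{r < t} - 1_{r < s}] dt ds`, for a kernel `g` that
vanishes on `(-∞, 0]`. -/
def prodKer (g U V : ℝ → ℂ) (r : ℝ) : ℂ :=
  ∫ p : ℝ × ℝ, U p.1 * V p.2 * g (p.1 + p.2 - r) * signFun p r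

variable {g U V : ℝ → ℂ} {M : ℝ} (hgm : Measurable g) (hg : Integrable g)
  (hUm : Measurable U) (hU : Integrable U) (hUb : ∀ t, ‖U t‖ ≤ M)
  (hVm : Measurable V) (hV : Integrable V) (hVb : ∀ t, ‖V t‖ ≤ M)

include hgm hg hUm hUb hV hVm in
-- Integrating in the first variable first, `U` is bounded by `M` and the translate of `g` keeps its
-- `L¹` norm, so the bound is uniform in `r`.
theorem integrable_prodKer_integrand (r : ℝ) :
    Integrable (fun p : ℝ × ℝ => U p.1 * V p.2 * g (p.1 + p.2 - r)) ∧
      ∫ p : ℝ × ℝ, ‖U p.1 * V p.2 * g (p.1 + p.2 - r)‖ ≤ (∫ b, ‖V b‖) * (M * ∫ y, ‖g y‖) := by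
  have hM : 0 ≤ M := (norm_nonneg _).trans (hUb 0)
  have hsec : ∀ b, Integrable fun a => g (a + b - r) := fun b => by
    simpa only [add_sub_assoc] using! hg.comp_add_right (b - r)
  have hi : ∀ b, Integrable fun a => U a * V b * g (a + b - r) := fun b =>
    (hsec b).bdd_mul (c := M * ‖V b‖) (hUm.mul_const _).aestronglyMeasurable
      (Eventually.of_forall fun a => by rw [norm_mul]; gcongr; exact hUb a)
  have hbd : ∀ b, ∫ a, ‖U a * V b * g (a + b - r)‖ ≤ ‖V b‖ * (M * ∫ y, ‖g y‖) := by
    intro b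
    have e : ∫ a, ‖g (a + b - r)‖ = ∫ y, ‖g y‖ := by
      simp only [add_sub_assoc]
      exact integral_add_right_eq_self (fun y => ‖g y‖) (b - r)
    rw [← e, ← integral_const_mul, ← integral_const_mul]
    refine integral_mono (hi b).norm (((hsec b).norm.const_mul _).const_mul _) fun a => ?_
    simp only [norm_mul]
    rw [mul_comm ‖U a‖, mul_assoc]
    gcongr
    exact hUb a
  have hmeas : Measurable fun p : ℝ × ℝ => U p.1 * V p.2 * g (p.1 + p.2 - r) := by fun_prop
  have hw : Integrable fun b => ‖V b‖ * (M * ∫ y, ‖g y‖) := hV.norm.mul_const _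
  have hint := integrable_prod_of_bound (μ := (volume : Measure ℝ)) (ν := volume) hmeas hw hi hbd
  refine ⟨hint, ?_⟩
  have h3 : ∫ p : ℝ × ℝ, ‖U p.1 * V p.2 * g (p.1 + p.2 - r)‖ =
      ∫ b, ∫ a, ‖U a * V b * g (a + b - r)‖ := integral_prod_symm _ hint.norm
  rw [h3, ← integral_mul_const]
  exact integral_mono hint.norm.integral_prod_right hw hbd

include hgm hUm hVm in
theorem measurable_prodKer : Measurable (prodKer g U V) := by
  have h : Measurable fun q : (ℝ × ℝ) × ℝ =>
      U q.1.1 * V q.1.2 * g (q.1.1 + q.1.2 - q.2) * signFun q.1 q.2 :=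
    Measurable.mul (by fun_prop) measurable_signFun
  exact h.stronglyMeasurable.integral_prod_left'.measurable

include hgm hg hUm hUb hV hVm in
theorem norm_prodKer_le (r : ℝ) :
    ‖prodKer g U V r‖ ≤ (∫ b, ‖V b‖) * (M * ∫ y, ‖g y‖) * 3 := by
  obtain ⟨h1, h2⟩ := integrable_prodKer_integrand hgm hg hUm hUb hVm hV r
  refine (norm_integral_le_of_norm_le (h1.norm.mul_const 3) (Eventually.of_forall fun p => ?_)).trans
    ?_
  · rw [norm_mul]
    gcongr
    exact norm_signFun_le p r
  · rw [integral_mul_const]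
    gcongr

include hgm hg hUm hU hV hVm in
/-- Integrating the product kernel against a bounded function. -/
theorem integral_prodKer_mul {F : ℝ → ℂ} (hF : Measurable F) {B : ℝ} (hFB : ∀ r, ‖F r‖ ≤ B) :
    ∫ r, prodKer g U V r * F r =
      ∫ t, ∫ s, U t * V s * ∫ r, g (t + s - r) * signFun (t, s) r * F r := by
  have hUV : Integrable fun p : ℝ × ℝ => U p.1 * V p.2 := hU.mul_prod hV
  have h1 : Integrable (fun q : (ℝ × ℝ) × ℝ => U q.1.1 * V q.1.2 * g (q.1.1 + q.1.2 - q.2))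
      ((volume : Measure (ℝ × ℝ)).prod volume) := by
    refine (integrable_prod_iff (Measurable.aestronglyMeasurable (by fun_prop))).2
      ⟨Eventually.of_forall fun p => (hg.comp_sub_left (p.1 + p.2)).const_mul (U p.1 * V p.2), ?_⟩
    simp only [norm_mul, integral_const_mul]
    have e : ∀ p : ℝ × ℝ, ∫ r, ‖g (p.1 + p.2 - r)‖ = ∫ y, ‖g y‖ := fun p =>
      integral_sub_left_eq_self (fun y => ‖g y‖) volume (p.1 + p.2)
    simp only [e]
    simpa only [norm_mul] using hUV.norm.mul_const (∫ y, ‖g y‖)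
  have h2 : Integrable (Function.uncurry fun (p : ℝ × ℝ) (r : ℝ) =>
      U p.1 * V p.2 * g (p.1 + p.2 - r) * (signFun p r * F r))
      ((volume : Measure (ℝ × ℝ)).prod volume) := by
    refine h1.mul_bdd (c := 3 * B) ?_ (Eventually.of_forall fun q => ?_)
    · exact (measurable_signFun.mul (hF.comp measurable_snd)).aestronglyMeasurable
    · rw [norm_mul]
      gcongr
      · exact norm_signFun_le _ _
      · exact hFB _
  have h3 := h2.integral_prod_left
  have e1 : ∫ r, prodKer g U V r * F r =
      ∫ r, ∫ p : ℝ × ℝ, U p.1 * V p.2 * g (p.1 + p.2 - r) * (signFun p r * F r) := by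
    congr 1
    funext r
    rw [prodKer, ← integral_mul_const]
    simp only [mul_assoc]
  rw [e1, ← integral_integral_swap h2]
  have h4 := integral_prod _ h3
  refine h4.trans ?_
  congr 1
  funext t
  congr 1
  funext s
  simp only [Function.uncurry]
  rw [← integral_const_mul]
  simp only [mul_assoc]

end ProductKernel

/-! ### The reflection identity and factorization of the product kernel. -/

section ProductIdentity

/-- The reflection `r ↦ a + b + τ - r` preserves `Q` and carries `r < b` to `r > a + τ`. After
removing `r < a` and `r > a + τ`, exactly `[a, a + τ]` remains. -/
theorem integral_mul_signFun {Q : ℝ → ℂ} (hQ : Integrable Q) {a b τ : ℝ} (hτ : 0 ≤ τ)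
    (hsymm : ∀ r, Q (a + b + τ - r) = Q r) :
    ∫ r, Q r * signFun (a, b) r = ∫ σ in Ioc 0 τ, Q (σ + a) := by
  have hi : ∀ s : Set ℝ, MeasurableSet s → Integrable (s.indicator Q) := fun s hs => hQ.indicator hs
  have e1 : ∀ r, Q r * signFun (a, b) r = Q r - (Iio a).indicator Q r - (Iio b).indicator Q r := by
    intro r
    by_cases h1 : r < a <;> by_cases h2 : r < b <;> simp [signFun, h1, h2]
  have e2 : ∫ r, (Iio b).indicator Q r = ∫ r, (Ioi (a + τ)).indicator Q r := by
    rw [← integral_sub_left_eq_self _ volume (a + b + τ)]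
    congr 1
    funext r
    by_cases h : a + τ < r
    · have : a + b + τ - r < b := by linarith
      simp [h, this, hsymm]
    · have : ¬ a + b + τ - r < b := by linarith
      simp [h, this]
  have e3 : ∫ σ in Ioc 0 τ, Q (σ + a) = ∫ r, (Icc a (a + τ)).indicator Q r := by
    rw [← intervalIntegral.integral_of_le hτ, intervalIntegral.integral_comp_add_right,
      zero_add, add_comm τ a, intervalIntegral.integral_of_le (by linarith),
      ← integral_Icc_eq_integral_Ioc, integral_indicator measurableSet_Icc]
  simp only [e1]
  have h1 : Integrable fun r => Q r - (Iio a).indicator Q r := hQ.sub (hi _ measurableSet_Iio)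
  rw [integral_sub h1 (hi _ measurableSet_Iio), e2, e3, ← integral_sub h1 (hi _ measurableSet_Ioi)]
  congr 1
  funext r
  by_cases h1 : r < a
  · have h2 : ¬ a + τ < r := by linarith
    have h3 : ¬ a ≤ r := by linarith
    simp [h1, h2, h3]
  · by_cases h2 : a + τ < r
    · have h3 : ¬ r ≤ a + τ := by linarith
      simp [h1, h2, h3]
    · have h3 : a ≤ r := by linarith
      have h4 : r ≤ a + τ := by linarith
      simp [h1, h2, h3, h4]

/-- The product kernel represents the finite convolution. -/
theorem integral_mul_prodKer {g U V : ℝ → ℂ} {M : ℝ} (hgm : Measurable g) (hg : Integrable g)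
    (hUm : Measurable U) (hUb : ∀ t, ‖U t‖ ≤ M)
    (hVm : Measurable V) (hV : Integrable V) (hVb : ∀ t, ‖V t‖ ≤ M) {τ : ℝ} (hτ : 0 ≤ τ) :
    ∫ r, g (r - τ) * prodKer g U V r =
      ∫ σ in (0 : ℝ)..τ, (∫ a, g (a - (τ - σ)) * U a) * ∫ b, g (b - σ) * V b := by
  have hM : 0 ≤ M := (norm_nonneg _).trans (hUb 0)
  have key := integrable_prodKer_integrand hgm hg hUm hUb hVm hV
  let H : (ℝ × ℝ) × ℝ → ℂ := fun q => g (q.2 - τ) * (U q.1.1 * V q.1.2 * g (q.1.1 + q.1.2 - q.2))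
  have hH : Integrable H ((volume : Measure (ℝ × ℝ)).prod volume) := by
    refine integrable_prod_of_bound (w := fun r => ‖g (r - τ)‖ * ((∫ b, ‖V b‖) * (M * ∫ y, ‖g y‖)))
      (by fun_prop) ((hg.comp_sub_right τ).norm.mul_const _) (fun r => (key r).1.const_mul (g (r - τ)))
      fun r => ?_
    simp only [H, norm_mul _ (_ * _ * _), integral_const_mul]
    gcongr
    exact (key r).2
  have hHs : Integrable (Function.uncurry fun (p : ℝ × ℝ) (r : ℝ) => H (p, r) * signFun p r)
      ((volume : Measure (ℝ × ℝ)).prod volume) :=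
    hH.mul_bdd (c := 3) measurable_signFun.aestronglyMeasurable
      (Eventually.of_forall fun q => norm_signFun_le _ _)
  let K : (ℝ × ℝ) × ℝ → ℂ := fun q => g (q.1.1 - (τ - q.2)) * U q.1.1 * (g (q.1.2 - q.2) * V q.1.2)
  have hb : ∀ (W : ℝ → ℂ) (c : ℝ), Measurable W → (∀ t, ‖W t‖ ≤ M) →
      Integrable (fun a => g (a - c) * W a) ∧ ∫ a, ‖g (a - c) * W a‖ ≤ (∫ y, ‖g y‖) * M := by
    intro W c hWm hWb
    have h1 : Integrable (fun a => g (a - c) * W a) :=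
      (hg.comp_sub_right c).mul_bdd hWm.aestronglyMeasurable (Eventually.of_forall hWb)
    refine ⟨h1, ?_⟩
    rw [← integral_sub_right_eq_self (fun y => ‖g y‖) c, ← integral_mul_const]
    refine integral_mono h1.norm ((hg.comp_sub_right c).norm.mul_const _) fun a => ?_
    simp only [norm_mul]
    gcongr
    exact hWb a
  have hK : Integrable K ((volume : Measure (ℝ × ℝ)).prod (volume.restrict (Ioc 0 τ))) := by
    refine integrable_prod_of_bound (w := fun _ => ((∫ y, ‖g y‖) * M) * ((∫ y, ‖g y‖) * M))
      (by fun_prop) (integrable_const _) (fun σ => ?_) fun σ => ?_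
    · exact (hb U (τ - σ) hUm hUb).1.mul_prod (hb V σ hVm hVb).1
    · have e : ∫ p : ℝ × ℝ, ‖K (p, σ)‖ =
          (∫ a, ‖g (a - (τ - σ)) * U a‖) * ∫ b, ‖g (b - σ) * V b‖ := by
        rw [← integral_prod_mul]
        simp only [K, norm_mul]
        rfl
      rw [e]
      exact mul_le_mul (hb U (τ - σ) hUm hUb).2 (hb V σ hVm hVb).2 (by positivity) (by positivity)
  have e1 : ∫ r, g (r - τ) * prodKer g U V r = ∫ r, ∫ p : ℝ × ℝ, H (p, r) * signFun p r := by
    congr 1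
    funext r
    rw [prodKer, ← integral_const_mul]
    simp only [H, mul_assoc]
  have e2 : ∫ σ in (0 : ℝ)..τ, (∫ a, g (a - (τ - σ)) * U a) * ∫ b, g (b - σ) * V b =
      ∫ σ in Ioc 0 τ, ∫ p : ℝ × ℝ, K (p, σ) := by
    rw [intervalIntegral.integral_of_le hτ]
    congr 1
    funext σ
    rw [← integral_prod_mul]
    rfl
  rw [e1, e2, ← integral_integral_swap hHs, ← integral_integral_swap (f := fun p σ => K (p, σ)) hK]
  refine integral_congr_ae ?_
  -- After Fubini the inner integrals agree for each `p` with an integrable section of `H`, hence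
  -- for almost every `p`; the symmetry exchanges the two factors `g`.
  filter_upwards [hH.prod_right_ae] with p hp
  rw [integral_mul_signFun (a := p.1) (b := p.2) hp hτ fun r => ?_]
  · congr 1
    funext σ
    simp only [H, K]
    rw [show σ + p.1 - τ = p.1 - (τ - σ) by ring, show p.1 + p.2 - (σ + p.1) = p.2 - σ by ring]
    ring
  · simp only [H]
    rw [show p.1 + p.2 + τ - r - τ = p.1 + p.2 - r by ring,
      show p.1 + p.2 - (p.1 + p.2 + τ - r) = r - τ by ring]
    ring

end ProductIdentity

/-! ### Identification of the product kernel with `W^α(f *₀ h)`. -/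

section ProductFormula

theorem conv0Fun_eq_zero {f h : ℝ → ℂ} {R : ℝ} (hf : ∀ t > R, f t = 0)
    (hh : ∀ t > R, h t = 0) : ∀ t > 2 * R, conv0Fun f h t = 0 := by
  intro t ht
  rw [conv0Fun]
  refine (intervalIntegral.integral_congr (g := fun _ => (0 : ℂ)) fun s _ => ?_).trans (by simp)
  rcases le_or_gt s R with hs | hs
  · simp [hf (t - s) (by linarith)]
  · simp [hh s hs]

variable {α : ℝ} {f h : ℝ → ℂ} {R : ℝ}

/-- The Weyl derivative of `f *₀ h` is the product kernel of the Weyl derivatives. -/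
theorem prodKer_ae_eq_weylDeriv (hα : 0 < α) (hR : 0 < R) (hf : ContDiff ℝ ∞ f)
    (hfc : HasCompactSupport f) (hfR : ∀ t > R, f t = 0) (hh : ContDiff ℝ ∞ h)
    (hhc : HasCompactSupport h) (hhR : ∀ t > R, h t = 0) (hc : ContDiff ℝ ∞ (conv0Fun f h))
    (hcc : HasCompactSupport (conv0Fun f h)) :
    ∀ᵐ r ∂volume.restrict (Ioi 0), prodKer (truncKer α (2 * R))
      ((Ioi 0).indicator (weylDeriv α f)) ((Ioi 0).indicator (weylDeriv α h)) r =
        weylDeriv α (conv0Fun f h) r := by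
  set g := truncKer α (2 * R) with hg'
  have hbd : ∀ f : ℝ → ℂ, ContDiff ℝ ∞ f → HasCompactSupport f → (∀ t > R, f t = 0) →
      ∃ M, ∀ t, ‖(Ioi 0).indicator (weylDeriv α f) t‖ ≤ M := by
    intro f hf hfc hfR
    obtain ⟨M, hM⟩ := exists_norm_le_of_hasCompactSupport
      (contDiff_iteratedDeriv hf ⌈α⌉₊).continuous (hasCompactSupport_iteratedDeriv hfc _)
    obtain ⟨c, hc0, hcM⟩ := exists_norm_weylDeriv_le α R
    refine ⟨c * M, fun t => ?_⟩
    have hM0 : 0 ≤ M := (norm_nonneg _).trans (hM 0)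
    by_cases ht : 0 < t
    · simpa [ht] using hcM f hf hfc hfR M hM t ht.le
    · simpa [ht] using mul_nonneg hc0 hM0
  obtain ⟨M₁, hM₁⟩ := hbd f hf hfc hfR
  obtain ⟨M₂, hM₂⟩ := hbd h hh hhc hhR
  have hmeas : ∀ f : ℝ → ℂ, ContDiff ℝ ∞ f → HasCompactSupport f →
      Measurable (weylDeriv α f) := fun f hf hfc => (continuous_weylDeriv α hf hfc).measurable
  have hind : ∀ f : ℝ → ℂ, ContDiff ℝ ∞ f → HasCompactSupport f →
      Measurable ((Ioi 0).indicator (weylDeriv α f)) := fun f hf hfc =>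
    (hmeas f hf hfc).indicator measurableSet_Ioi
  set U := (Ioi 0).indicator (weylDeriv α f) with hU
  set V := (Ioi 0).indicator (weylDeriv α h) with hV
  have hUb : ∀ t, ‖U t‖ ≤ max M₁ M₂ := fun t => (hM₁ t).trans (le_max_left _ _)
  have hVb : ∀ t, ‖V t‖ ≤ max M₁ M₂ := fun t => (hM₂ t).trans (le_max_right _ _)
  have hUR : ∀ t > R, U t = 0 := fun t ht => by
    simp [U, indicator, weylDeriv_eq_zero α hf hfc hfR t ht]
  have hVR : ∀ t > R, V t = 0 := fun t ht => by
    simp [V, indicator, weylDeriv_eq_zero α hh hhc hhR t ht]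
  have hVi : Integrable V := integrable_indicator_of_bounded (hmeas h hh hhc)
    (fun s hs => by simpa [V, hs] using hM₂ s) (weylDeriv_eq_zero α hh hhc hhR)
  have hgm : Measurable g := measurable_truncKer _ _
  have hgi : Integrable g := integrable_truncKer hα _
  have hkR : ∀ r > 2 * R, prodKer g U V r = 0 := by
    intro r hr
    rw [prodKer]
    refine (integral_congr_ae (g := fun _ => (0 : ℂ)) (Eventually.of_forall fun p => ?_)).trans
      (by simp)
    rcases le_or_gt p.1 R with h1 | h1
    · rcases le_or_gt p.2 R with h2 | h2
      · have : p.1 + p.2 - r ∉ Ioc 0 (2 * R) := fun h => by linarith [h.1]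
        simp only [g]
        rw [show truncKer α (2 * R) (p.1 + p.2 - r) = 0 from indicator_of_notMem this _]
        simp
      · simp [hVR _ h2]
    · simp [hUR _ h1]
  have hwR : ∀ r > 2 * R, weylDeriv α (conv0Fun f h) r = 0 :=
    weylDeriv_eq_zero α hc hcc (conv0Fun_eq_zero hfR hhR)
  -- At `c ≥ 0` the fractional integral sees only arguments beyond `c`, where the cut-off is
  -- invisible; hence `I^α W^α f = f` still applies.
  have hpart : ∀ f : ℝ → ℂ, ContDiff ℝ ∞ f → HasCompactSupport f → (∀ t > R, f t = 0) →
      ∀ c ≥ 0, ∫ a, g (a - c) * (Ioi 0).indicator (weylDeriv α f) a = f c := by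
    intro f hf hfc hfR c hc0
    rw [← fracInt_weylDeriv hα.le hf hfc c, ← fracInt_eq_truncKer hα (R := R)
      (fun s hs => by simp [indicator, weylDeriv_eq_zero α hf hfc hfR s hs]) (by linarith)]
    exact fracInt_congr_of_pos hα fun s hs => by simp [lt_of_le_of_lt hc0 hs]
  obtain ⟨Mw, hMw⟩ : ∃ Mw, ∀ t ≥ 0, ‖weylDeriv α (conv0Fun f h) t‖ ≤ Mw := by
    obtain ⟨M, hM⟩ := exists_norm_le_of_hasCompactSupport
      (contDiff_iteratedDeriv hc ⌈α⌉₊).continuous (hasCompactSupport_iteratedDeriv hcc _)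
    obtain ⟨c, -, hcM⟩ := exists_norm_weylDeriv_le α (2 * R)
    exact ⟨c * M, hcM _ hc hcc (conv0Fun_eq_zero hfR hhR) M hM⟩
  have hkb := norm_prodKer_le hgm hgi (hind f hf hfc) hUb (hind h hh hhc) hVi
  set B := (∫ b, ‖V b‖) * (max M₁ M₂ * ∫ y, ‖g y‖) * 3
  have hkm : Measurable (prodKer g U V) := measurable_prodKer hgm (hind f hf hfc) (hind h hh hhc)
  have hwm := hmeas _ hc hcc
  -- Injectivity of `I^α` is applied to the difference of the two sides, which is bounded on `(0,
  -- ∞)` and vanishes beyond `2 * R`.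
  have main := ae_eq_zero_of_fracInt_eq_zero (R := 2 * R) (M := B + Mw) hα
    (h := fun r => prodKer g U V r + (-1) * weylDeriv α (conv0Fun f h) r)
    (hkm.add (hwm.const_mul _))
    (fun s hs => (norm_add_le _ _).trans (add_le_add (hkb s) (by simpa using hMw s hs.le)))
    (fun s hs => by rw [hkR s hs, hwR s hs]; simp) ?_
  · filter_upwards [main] with r hr
    linear_combination hr
  · intro t ht
    rw [fracInt_add (R := 2 * R) (M := max B Mw) hα.le hkm
      (fun s _ => (hkb s).trans (le_max_left _ _)) hkR (hwm.const_mul _)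
      (fun s hs => le_trans (by simpa using hMw s (ht.trans hs).le) (le_max_right _ _))
      (fun s hs => by rw [hwR s hs, mul_zero]), fracInt_const_mul,
      fracInt_weylDeriv hα.le hc hcc, fracInt_eq_truncKer hα hkR (T := 2 * R) (by linarith),
      integral_mul_prodKer hgm hgi (hind f hf hfc) hUb (hind h hh hhc) hVi hVb ht.le, conv0Fun]
    rw [intervalIntegral.integral_congr (g := fun s => f (t - s) * h s), neg_one_mul,
      add_neg_cancel]
    intro σ hσ
    rw [uIcc_of_le ht.le] at hσ
    beta_reduce
    rw [hpart f hf hfc hfR _ (by linarith [hσ.2]), hpart h hh hhc hhR _ hσ.1]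

end ProductFormula

/-! ### Scalar identities behind the product formula and the generator. -/

section ScalarIdentities

/-- A continuous function on `[0, ∞)`, cut off outside `(0, R]`. -/
def cutoff (R : ℝ) (F : ℝ → ℂ) : ℝ → ℂ := (Ioc 0 R).indicator F

theorem cutoff_eq_max (R : ℝ) (F : ℝ → ℂ) :
    cutoff R F = (Ioc 0 R).indicator fun r => F (max r 0) := by
  funext r
  by_cases hr : r ∈ Ioc 0 R
  · simp [cutoff, hr, max_eq_left hr.1.le]
  · simp [cutoff, hr]

theorem continuous_comp_max {F : ℝ → ℂ} (hF : ContinuousOn F (Ici 0)) :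
    Continuous fun r => F (max r 0) :=
  hF.comp_continuous (by fun_prop) fun r => le_max_right r 0

theorem measurable_cutoff (R : ℝ) {F : ℝ → ℂ} (hF : ContinuousOn F (Ici 0)) :
    Measurable (cutoff R F) := by
  rw [cutoff_eq_max]
  exact (continuous_comp_max hF).measurable.indicator measurableSet_Ioc

theorem exists_norm_cutoff_le (R : ℝ) {F : ℝ → ℂ} (hF : ContinuousOn F (Ici 0)) :
    ∃ B, ∀ r, ‖cutoff R F r‖ ≤ B := by
  obtain ⟨B, hB⟩ := isCompact_Icc.exists_bound_of_continuousOn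
    (hF.mono (Icc_subset_Ici_self : Icc 0 R ⊆ Ici 0))
  refine ⟨max B 0, fun r => ?_⟩
  by_cases hr : r ∈ Ioc 0 R
  · rw [cutoff, indicator_of_mem hr]
    exact (hB r (Ioc_subset_Icc_self hr)).trans (le_max_left _ _)
  · simp [cutoff, hr]

theorem integrable_cutoff (R : ℝ) {F : ℝ → ℂ} (hF : ContinuousOn F (Ici 0)) :
    Integrable (cutoff R F) :=
  (integrable_indicator_iff measurableSet_Ioc).2
    ((hF.mono Icc_subset_Ici_self).integrableOn_Icc.mono_set Ioc_subset_Icc_self)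

theorem integral_mul_cutoff {k : ℝ → ℂ} {F : ℝ → ℂ} {R : ℝ} (hk : ∀ r > R, k r = 0) :
    ∫ r, k r * cutoff R F r = ∫ r in Ioi 0, k r * F r := by
  rw [← integral_indicator measurableSet_Ioi]
  congr 1
  funext r
  by_cases h0 : 0 < r
  · by_cases hR : r ≤ R
    · simp [cutoff, h0, hR]
    · simp [hk r (not_le.1 hR), indicator]
  · simp [cutoff, h0]

theorem setIntegral_gFun_mul_eq {α R c d : ℝ} (hc : c ≤ d) (hd : d ≤ R) {F : ℝ → ℂ} :
    ∫ r in Ioc 0 c, (gFun α (d - r) : ℂ) * F r =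
      ∫ r, (Iio c).indicator (fun r => truncKer α R (d - r) * cutoff R F r) r := by
  rw [integral_Ioc_eq_integral_Ioo, ← integral_indicator measurableSet_Ioo]
  congr 1
  funext r
  by_cases h0 : 0 < r
  · by_cases h1 : r < c
    · have h2 : d - r ∈ Ioc 0 R := ⟨by linarith, by linarith⟩
      have h3 : r ∈ Ioc 0 R := ⟨h0, by linarith⟩
      have h4 : r ∈ Ioo 0 c := ⟨h0, h1⟩
      rw [indicator_of_mem h4, indicator_of_mem (show r ∈ Iio c from h1), truncKer, cutoff,
        indicator_of_mem h2, indicator_of_mem h3]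
    · simp [h1]
  · simp [cutoff, h0, indicator]

theorem setIntegral_gFun_combination {α R t s : ℝ} (hα : 0 < α) (ht : 0 ≤ t) (hs : 0 ≤ s)
    (hR : t + s ≤ R) {F : ℝ → ℂ} (hF : ContinuousOn F (Ici 0)) :
    (∫ r in Ioc 0 (t + s), (gFun α (t + s - r) : ℂ) * F r) -
      (∫ r in Ioc 0 t, (gFun α (t + s - r) : ℂ) * F r) -
      (∫ r in Ioc 0 s, (gFun α (t + s - r) : ℂ) * F r) =
      ∫ r, truncKer α R (t + s - r) * signFun (t, s) r * cutoff R F r := by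
  obtain ⟨B, hB⟩ := exists_norm_cutoff_le R hF
  set Q : ℝ → ℂ := fun r => truncKer α R (t + s - r) * cutoff R F r with hQ'
  have hQ : Integrable Q := ((integrable_truncKer hα R).comp_sub_left (t + s)).mul_bdd
    (measurable_cutoff R hF).aestronglyMeasurable (Eventually.of_forall hB)
  -- The truncated kernel vanishes at nonpositive arguments, so the restriction `r < t + s` is
  -- automatic and accounts for the constant `1` in `signFun`.
  have e0 : (Iio (t + s)).indicator Q = Q := by
    refine indicator_eq_self.2 fun r hr => ?_
    by_contra h
    have : t + s - r ∉ Ioc 0 R := fun h' => h (by simpa using h'.1)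
    exact hr (by simp only [Q]; rw [show truncKer α R (t + s - r) = 0 from
      indicator_of_notMem this _, zero_mul])
  have h1 : Integrable fun r => Q r - (Iio t).indicator Q r :=
    hQ.sub (hQ.indicator measurableSet_Iio)
  rw [setIntegral_gFun_mul_eq le_rfl hR, setIntegral_gFun_mul_eq (by linarith) hR,
    setIntegral_gFun_mul_eq (by linarith) hR, e0, ← integral_sub hQ (hQ.indicator measurableSet_Iio),
    ← integral_sub h1 (hQ.indicator measurableSet_Iio)]
  congr 1
  funext r
  by_cases h1 : r < t <;> by_cases h2 : r < s <;> simp [signFun, h1, h2, Q]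

variable {α R : ℝ} {f h : ℝ → ℂ}

/-- The product formula after applying a functional `f'`: `F(r)` stands for `f'(S(r) C x)` and `Φ t
s` for `f'(S(t) S(s) x)`, related by the semigroup law. -/
theorem integral_weylDeriv_conv0Fun (hα : 0 < α) (hR : 0 < R) (hf : ContDiff ℝ ∞ f)
    (hfc : HasCompactSupport f) (hfR : ∀ t > R, f t = 0) (hh : ContDiff ℝ ∞ h)
    (hhc : HasCompactSupport h) (hhR : ∀ t > R, h t = 0) (hc : ContDiff ℝ ∞ (conv0Fun f h))
    (hcc : HasCompactSupport (conv0Fun f h)) {F : ℝ → ℂ} (hF : ContinuousOn F (Ici 0))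
    {Φ : ℝ → ℝ → ℂ} (hΦ : ∀ t > 0, ∀ s > 0, Φ t s =
      (∫ r in Ioc 0 (t + s), (gFun α (t + s - r) : ℂ) * F r) -
      (∫ r in Ioc 0 t, (gFun α (t + s - r) : ℂ) * F r) -
      (∫ r in Ioc 0 s, (gFun α (t + s - r) : ℂ) * F r)) :
    ∫ r in Ioi 0, weylDeriv α (conv0Fun f h) r * F r =
      ∫ t in Ioi 0, weylDeriv α f t * ∫ s in Ioi 0, weylDeriv α h s * Φ t s := by
  have hwR : ∀ r > 2 * R, weylDeriv α (conv0Fun f h) r = 0 :=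
    weylDeriv_eq_zero α hc hcc (conv0Fun_eq_zero hfR hhR)
  have hprep : ∀ f : ℝ → ℂ, ContDiff ℝ ∞ f → HasCompactSupport f → (∀ t > R, f t = 0) →
      Measurable ((Ioi 0).indicator (weylDeriv α f)) ∧
      Integrable ((Ioi 0).indicator (weylDeriv α f)) := by
    intro f hf hfc hfR
    have hm := (continuous_weylDeriv α hf hfc).measurable
    obtain ⟨M, hM⟩ := exists_norm_le_of_hasCompactSupport
      (contDiff_iteratedDeriv hf ⌈α⌉₊).continuous (hasCompactSupport_iteratedDeriv hfc _)
    obtain ⟨c, hc0, hcM⟩ := exists_norm_weylDeriv_le α R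
    exact ⟨hm.indicator measurableSet_Ioi, integrable_indicator_of_bounded hm
      (fun s hs => hcM f hf hfc hfR M hM s (le_of_lt hs)) (weylDeriv_eq_zero α hf hfc hfR)⟩
  obtain ⟨B, hB⟩ := exists_norm_cutoff_le (2 * R) hF
  have hFm := measurable_cutoff (2 * R) hF
  obtain ⟨hUm, hUi⟩ := hprep f hf hfc hfR
  obtain ⟨hVm, hVi⟩ := hprep h hh hhc hhR
  have main := integral_prodKer_mul (measurable_truncKer α (2 * R)) (integrable_truncKer hα (2 * R))
    hUm hUi hVm hVi hFm hB
  have e1 : ∫ r in Ioi 0, weylDeriv α (conv0Fun f h) r * F r =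
      ∫ r, prodKer (truncKer α (2 * R)) ((Ioi 0).indicator (weylDeriv α f))
        ((Ioi 0).indicator (weylDeriv α h)) r * cutoff (2 * R) F r := by
    rw [← integral_mul_cutoff hwR]
    refine integral_congr_ae ?_
    have hae := (ae_restrict_iff' measurableSet_Ioi).1
      (prodKer_ae_eq_weylDeriv hα hR hf hfc hfR hh hhc hhR hc hcc)
    filter_upwards [hae] with r hr
    by_cases h0 : 0 < r
    · rw [hr h0]
    · simp [cutoff, h0]
  rw [e1, main, ← integral_indicator measurableSet_Ioi]
  congr 1
  funext t
  by_cases ht : 0 < t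
  · simp only [indicator_of_mem (show t ∈ Ioi 0 from ht)]
    rw [← integral_const_mul, ← integral_indicator measurableSet_Ioi]
    congr 1
    funext s
    by_cases hs : 0 < s
    · simp only [indicator_of_mem (show s ∈ Ioi 0 from hs)]
      rcases le_or_gt t R with htR | htR
      · rcases le_or_gt s R with hsR | hsR
        · rw [hΦ t ht s hs,
            setIntegral_gFun_combination hα ht.le hs.le (R := 2 * R) (by linarith) hF]
          ring
        · simp [weylDeriv_eq_zero α hh hhc hhR s hsR]
      · simp [weylDeriv_eq_zero α hf hfc hfR t htR]
    · simp [hs]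
  · simp [ht]

/-- The counterpart for `α = 0`: Fubini and the substitution `r = t + s`. -/
theorem integral_conv0Fun (hf : Continuous f)
    (hfc : HasCompactSupport f) (hfR : ∀ t > R, f t = 0) (hh : Continuous h)
    (hhc : HasCompactSupport h) (hhR : ∀ t > R, h t = 0)
    {F : ℝ → ℂ} (hF : ContinuousOn F (Ici 0)) :
    ∫ r in Ioi 0, conv0Fun f h r * F r =
      ∫ t in Ioi 0, f t * ∫ s in Ioi 0, h s * F (t + s) := by
  set U := (Ioi 0).indicator f with hU
  set V := (Ioi 0).indicator h with hV
  have hUi : Integrable U := (hf.integrable_of_hasCompactSupport hfc).indicator measurableSet_Ioi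
  have hVi : Integrable V := (hh.integrable_of_hasCompactSupport hhc).indicator measurableSet_Ioi
  obtain ⟨B, hB⟩ := exists_norm_cutoff_le (2 * R) hF
  have hFm := measurable_cutoff (2 * R) hF
  set F₁ := cutoff (2 * R) F with hF₁
  have hi1 : Integrable (Function.uncurry fun t s => U t * V s * F₁ (t + s))
      (volume.prod volume) :=
    (hUi.mul_prod hVi).mul_bdd (hFm.comp (measurable_fst.add measurable_snd)).aestronglyMeasurable
      (Eventually.of_forall fun p => hB _)
  have hi2 : Integrable (Function.uncurry fun s r => V s * U (r - s) * F₁ r)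
      (volume.prod volume) := by
    have h1 := (Integrable.convolution_integrand (ContinuousLinearMap.mul ℝ ℂ) hVi hUi).swap
    exact h1.mul_bdd (hFm.comp measurable_snd).aestronglyMeasurable
      (Eventually.of_forall fun p => hB _)
  have e1 : ∫ t in Ioi 0, f t * ∫ s in Ioi 0, h s * F (t + s) =
      ∫ t, ∫ s, U t * V s * F₁ (t + s) := by
    rw [← integral_indicator measurableSet_Ioi]
    congr 1
    funext t
    by_cases ht : 0 < t
    · rw [indicator_of_mem (show t ∈ Ioi 0 from ht), ← integral_const_mul,
        ← integral_indicator measurableSet_Ioi]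
      congr 1
      funext s
      by_cases hs : 0 < s
      · rcases le_or_gt t R with htR | htR
        · rcases le_or_gt s R with hsR | hsR
          · have h1 : t + s ∈ Ioc 0 (2 * R) := ⟨by linarith, by linarith⟩
            simp [U, V, F₁, cutoff, ht, hs, h1, mul_assoc]
          · simp [V, hhR s hsR, indicator]
        · simp [U, hfR t htR, indicator]
      · simp [V, hs]
    · simp [U, ht]
  have e2 : ∫ r in Ioi 0, conv0Fun f h r * F r = ∫ r, ∫ s, V s * U (r - s) * F₁ r := by
    rw [← integral_mul_cutoff (conv0Fun_eq_zero hfR hhR)]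
    congr 1
    funext r
    rw [integral_mul_const]
    by_cases hr : 0 < r
    · congr 1
      rw [conv0Fun, intervalIntegral.integral_of_le hr.le, integral_Ioc_eq_integral_Ioo,
        ← integral_indicator measurableSet_Ioo]
      congr 1
      funext s
      by_cases h1 : 0 < s <;> by_cases h2 : s < r <;> simp [U, V, h1, h2, mul_comm]
    · simp [cutoff, F₁, hr]
  rw [e1, e2, integral_integral_swap hi1, ← integral_integral_swap hi2]
  congr 1
  funext s
  rw [← integral_sub_right_eq_self (fun t => U t * V s * F₁ (t + s)) s]
  congr 1
  funext r
  simp only [sub_add_cancel]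
  ring

theorem weylDeriv_zero (hf : ContDiff ℝ ∞ f) (hfc : HasCompactSupport f) : weylDeriv 0 f = f := by
  funext t
  simpa [fracInt_zero] using fracInt_weylDeriv le_rfl hf hfc t

/-- Integration by parts for the primitive of a continuous function. -/
theorem integral_mul_primitive {w : ℝ → ℂ} (hw : Continuous w) (hwR : ∀ t > R, w t = 0)
    {F : ℝ → ℂ} (hF : ContinuousOn F (Ici 0)) :
    IntegrableOn (fun t => w t * ∫ s in Ioc 0 t, F s) (Ioi 0) ∧
      ∫ t in Ioi 0, w t * ∫ s in Ioc 0 t, F s = ∫ s in Ioi 0, fracInt 1 w s * F s := by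
  have hFi := integrable_cutoff R hF
  have hwi := integrable_cutoff R (hw.continuousOn (s := Ici 0))
  have hT : MeasurableSet {p : ℝ × ℝ | p.2 < p.1} := measurableSet_lt measurable_snd measurable_fst
  -- Fubini on the triangle `0 < s < t ≤ R`.
  have hi : Integrable (Function.uncurry fun t s =>
      {p : ℝ × ℝ | p.2 < p.1}.indicator (fun p => cutoff R w p.1 * cutoff R F p.2) (t, s))
      (volume.prod volume) := (hwi.mul_prod hFi).indicator hT
  have e1 : (Ioi 0).indicator (fun t => w t * ∫ s in Ioc 0 t, F s) = fun t => ∫ s,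
      {p : ℝ × ℝ | p.2 < p.1}.indicator (fun p => cutoff R w p.1 * cutoff R F p.2) (t, s) := by
    funext t
    by_cases ht : 0 < t
    · by_cases htR : t ≤ R
      · rw [indicator_of_mem (show t ∈ Ioi 0 from ht), integral_Ioc_eq_integral_Ioo,
          ← integral_const_mul, ← integral_indicator measurableSet_Ioo]
        congr 1
        funext s
        by_cases h1 : 0 < s
        · by_cases h2 : s < t
          · simp [cutoff, ht, htR, h1, h2, h2.le.trans htR]
          · simp [h2]
        · simp [cutoff, h1, indicator]
      · simp [hwR t (not_le.1 htR), cutoff, htR, indicator]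
    · simp [cutoff, ht, indicator]
  refine ⟨?_, ?_⟩
  · rw [← integrable_indicator_iff measurableSet_Ioi, e1]
    exact hi.integral_prod_left
  · rw [← integral_indicator measurableSet_Ioi, e1, integral_integral_swap hi,
      ← integral_mul_cutoff (fun s hs => fracInt_eq_zero hwR hs)]
    congr 1
    funext s
    by_cases hs : s ∈ Ioc 0 R
    · rw [fracInt_one, ← integral_mul_const, ← integral_indicator measurableSet_Ioi]
      congr 1
      funext t
      by_cases h1 : s < t
      · by_cases h2 : t ≤ R
        · simp [cutoff, h1, h2, hs.1.trans h1]
        · simp [cutoff, h1, h2, hwR t (not_le.1 h2)]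
      · simp [h1]
    · have : cutoff R F s = 0 := indicator_of_notMem hs _
      simp [this, indicator]

end ScalarIdentities

/-! ### Vector-valued integrals and the assembly of the theorem. -/

section VectorIntegral

variable {E : Type*} [AddCommGroup E] [Module ℂ E] [TopologicalSpace E]

theorem HasVectorIntegral.congr {F G : ℝ → E} {s : Set ℝ} {v : E} (hs : MeasurableSet s)
    (hF : HasVectorIntegral F s v) (h : ∀ t ∈ s, F t = G t) : HasVectorIntegral G s v := by
  intro f
  have e : EqOn (fun t => f (F t)) (fun t => f (G t)) s := fun t ht => by simp only [h t ht]
  exact ⟨(hF f).1.congr_fun e hs, by rw [← setIntegral_congr_fun hs e]; exact (hF f).2⟩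

theorem HasVectorIntegral.map {F : ℝ → E} {s : Set ℝ} {v : E} (hF : HasVectorIntegral F s v)
    (T : E →L[ℂ] E) : HasVectorIntegral (fun t => T (F t)) s (T v) :=
  fun f => hF (f.comp T)

theorem hasVectorIntegral_zero (s : Set ℝ) : HasVectorIntegral (fun _ => (0 : E)) s 0 := by
  intro f
  simp

end VectorIntegral

section Main

variable {E : Type*} [AddCommGroup E] [Module ℂ E] [Module ℝ E] [IsScalarTower ℝ ℂ E]
    [UniformSpace E] [IsUniformAddGroup E] [ContinuousSMul ℂ E] [LocallyConvexSpace ℝ E]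
    [T2Space E] {α : ℝ} {C : E →L[ℂ] E} {S : ℝ → E →L[ℂ] E} {G : TestFn →L[ℂ] (E →L[ℂ] E)}

theorem exists_common_bound (φ ψ : TestFn) :
    ∃ R > 0, (∀ t > R, φ t = 0) ∧ ∀ t > R, ψ t = 0 := by
  obtain ⟨R, hR, h⟩ := exists_eq_zero_of_hasCompactSupport φ.hasCompactSupport
  obtain ⟨R', hR', h'⟩ := exists_eq_zero_of_hasCompactSupport ψ.hasCompactSupport
  exact ⟨max R R', lt_max_of_lt_left hR, fun t ht => h t ((le_max_left _ _).trans_lt ht),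
    fun t ht => h' t ((le_max_right _ _).trans_lt ht)⟩

theorem weylDeriv_distribution_mul (hα : 0 ≤ α) (hS : IsIntegratedCSemigroup α C S)
    (hG : ∀ (φ : TestFn) (x : E),
      HasVectorIntegral (fun t => weylDeriv α φ t • S t x) (Ioi 0) (G φ x))
    (φ ψ : TestFn) (x : E) : G (conv0 φ ψ) (C x) = G φ (G ψ x) := by
  refine (hG (conv0 φ ψ) (C x)).unique fun f => ⟨(hG (conv0 φ ψ) (C x) f).1, ?_⟩
  obtain ⟨R, hR, hφ, hψ⟩ := exists_common_bound φ ψ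
  have hF : ContinuousOn (fun r => f (S r (C x))) (Ici 0) :=
    f.continuous.comp_continuousOn (hS.continuousOn (C x))
  have e1 := (hG φ (G ψ x) f).2
  -- The functional `f ∘ S(t)` is itself continuous, so it passes through the weak integral defining
  -- `G ψ x`.
  have e2 : ∀ t, f (S t (G ψ x)) = ∫ s in Ioi 0, weylDeriv α ψ s * f (S t (S s x)) := fun t => by
    simpa using! ((hG ψ x).map (S t) f).2.symm
  simp only [map_smul, smul_eq_mul, e2] at e1
  rw [← e1]
  simp only [map_smul, smul_eq_mul]
  rcases hα.eq_or_lt with rfl | hα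
  · rw [weylDeriv_zero φ.contDiff φ.hasCompactSupport, weylDeriv_zero ψ.contDiff
      ψ.hasCompactSupport, weylDeriv_zero (conv0 φ ψ).contDiff (conv0 φ ψ).hasCompactSupport]
    refine (integral_conv0Fun φ.continuous φ.hasCompactSupport hφ ψ.continuous
      ψ.hasCompactSupport hψ hF).trans ?_
    refine setIntegral_congr_fun measurableSet_Ioi fun t ht => ?_
    congr 1
    refine setIntegral_congr_fun measurableSet_Ioi fun s hs => ?_
    rw [hS.mul_zero rfl t s (le_of_lt ht) (le_of_lt hs)]
  · refine integral_weylDeriv_conv0Fun hα hR φ.contDiff φ.hasCompactSupport hφ ψ.contDiff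
      ψ.hasCompactSupport hψ (conv0 φ ψ).contDiff (conv0 φ ψ).hasCompactSupport hF
      fun t ht s hs => ?_
    obtain ⟨I₁, I₂, I₃, h1, h2, h3, h⟩ := hS.mul_pos hα t s ht.le hs.le x
    rw [h, map_sub, map_sub, ← (h1 f).2, ← (h2 f).2, ← (h3 f).2]
    simp only [map_smul, smul_eq_mul]

theorem isPreCDS_of_hasVectorIntegral (hα : 0 ≤ α) (hS : IsIntegratedCSemigroup α C S)
    (hG : ∀ (φ : TestFn) (x : E),
      HasVectorIntegral (fun t => weylDeriv α φ t • S t x) (Ioi 0) (G φ x)) : IsPreCDS C G where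
  support φ hφ := by
    ext x
    have h0 : ∀ t > 0, φ t = 0 := fun t ht =>
      image_eq_zero_of_notMem_tsupport fun h => lt_asymm ht (hφ h)
    refine (hG φ x).unique ((hasVectorIntegral_zero _).congr measurableSet_Ioi fun t ht => ?_)
    rw [weylDeriv_eq_zero α φ.contDiff φ.hasCompactSupport h0 t ht, zero_smul]
  comm φ := by
    ext x
    refine ((hG φ x).map C).unique ((hG φ (C x)).congr measurableSet_Ioi fun t ht => ?_)
    rw [hS.comm t (le_of_lt ht), map_smul]
  mul φ ψ := by
    ext x
    exact weylDeriv_distribution_mul hα hS hG φ ψ x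

/-- The integral is `I^(α+1) W^α f'` at `0`. Splitting off `I^α`, which inverts `W^α`, leaves `I^1
f'(0) = -f(0)`. -/
theorem gFun_add_one_integral (hα : 0 ≤ α) {f : ℝ → ℂ} (hf : ContDiff ℝ ∞ f)
    (hc : HasCompactSupport f) :
    ∫ t in Ioi 0, weylDeriv α (deriv f) t * (gFun (α + 1) t : ℂ) = -f 0 := by
  have hf' := (contDiff_infty_iff_deriv.1 hf).2
  have hw := continuous_weylDeriv α hf' hc.deriv
  obtain ⟨R, hR, hfR⟩ := exists_eq_zero_of_hasCompactSupport hc.deriv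
  obtain ⟨M, hM⟩ := exists_norm_le_of_hasCompactSupport
    (contDiff_iteratedDeriv hf' ⌈α⌉₊).continuous (hasCompactSupport_iteratedDeriv hc.deriv _)
  obtain ⟨c, -, hcM⟩ := exists_norm_weylDeriv_le α R
  rw [← fracInt_one_deriv hf hc,
    fracInt_congr (h' := fracInt α (weylDeriv α (deriv f)))
      (fun s _ => (fracInt_weylDeriv hα hf' hc.deriv s).symm),
    fracInt_fracInt zero_le_one hα hw.measurable
      (fun s hs => hcM _ hf' hc.deriv hfR M hM s (le_of_lt hs))
      (weylDeriv_eq_zero α hf' hc.deriv hfR), add_comm, fracInt_of_pos (by linarith)]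
  simp only [sub_zero, mul_comm]

theorem integralGenerator_le_distGenerator (hα : 0 ≤ α) (hS : IsIntegratedCSemigroup α C S)
    (hG : ∀ (φ : TestFn) (x : E),
      HasVectorIntegral (fun t => weylDeriv α φ t • S t x) (Ioi 0) (G φ x)) :
    integralGenerator α C S ≤ distGenerator G := by
  rintro ⟨x, y⟩ hxy φ hφ
  refine HasVectorIntegral.unique (fun f => ⟨(hG φ y f).1, ?_⟩) (hG φ y)
  -- `φ` vanishes on `(-∞, 0)`, hence at `0` by continuity; this kills the `C x` term.
  have hφ0 : φ 0 = 0 := by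
    have h : EqOn φ (fun _ => 0) (Iio 0) := fun t ht =>
      image_eq_zero_of_notMem_tsupport fun h => not_lt.2 (mem_Ici.1 (hφ h)) ht
    have h2 := h.closure φ.continuous continuous_const
    rw [closure_Iio] at h2
    exact h2 (mem_Iic.2 le_rfl)
  set θ : ℝ → ℂ := fun t => (-1) * φ t with hθ
  have hθs : ContDiff ℝ ∞ θ := contDiff_const.mul φ.contDiff
  have hθc : HasCompactSupport θ := φ.hasCompactSupport.mul_left
  have hθ' : ContDiff ℝ ∞ (deriv θ) := (contDiff_infty_iff_deriv.1 hθs).2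
  obtain ⟨R, hR, hθR⟩ := exists_eq_zero_of_hasCompactSupport hθc.deriv
  have hF : ContinuousOn (fun r => f (S r y)) (Ici 0) :=
    f.continuous.comp_continuousOn (hS.continuousOn y)
  have e0 : ⇑(-testDeriv φ) = deriv θ := by
    funext t
    simp only [θ, neg_one_mul, deriv.fun_neg]
    rfl
  obtain ⟨i1, e1⟩ := hG (-testDeriv φ) x f
  rw [e0] at i1 e1
  simp only [map_smul, smul_eq_mul] at i1 e1
  obtain ⟨i2, e2⟩ := integral_mul_primitive (continuous_weylDeriv α hθ' hθc.deriv)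
    (weylDeriv_eq_zero α hθ' hθc.deriv hθR) hF
  -- By the generator relation the integrand is `W^α θ'(t) g_{α+1}(t) f(C x)` with `θ = -φ`, whose
  -- integral is a multiple of `θ(0) = 0`.
  have e3 : ∫ t in Ioi 0, (weylDeriv α (deriv θ) t * f (S t x) -
      weylDeriv α (deriv θ) t * ∫ s in Ioc 0 t, f (S s y)) = 0 := by
    have : ∀ t ∈ Ioi (0 : ℝ), weylDeriv α (deriv θ) t * f (S t x) -
        weylDeriv α (deriv θ) t * ∫ s in Ioc 0 t, f (S s y) =
        weylDeriv α (deriv θ) t * (gFun (α + 1) t : ℂ) * f (C x) := by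
      intro t ht
      have h := (hxy t (le_of_lt ht) f).2
      simp only [map_sub, map_smul, smul_eq_mul] at h
      rw [h]
      ring
    rw [setIntegral_congr_fun measurableSet_Ioi this, integral_mul_const,
      gFun_add_one_integral hα hθs hθc]
    simp [θ, hφ0]
  rw [integral_sub i1 i2, sub_eq_zero, e1, e2] at e3
  change _ = f (G (-testDeriv φ) x)
  rw [e3]
  simp only [map_smul, smul_eq_mul]
  congr 1
  funext s
  rw [fracInt_one_weylDeriv_deriv α hθs hθc, weylDeriv_const_mul α _ φ.contDiff φ.hasCompactSupport]
  ring

end Main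

end DegenerateCSemigroup

end
open DegenerateCSemigroup in
theorem theorem4p6 {E : Type*} [AddCommGroup E] [Module ℂ E] [Module ℝ E] [IsScalarTower ℝ ℂ E]
    [UniformSpace E] [IsUniformAddGroup E] [ContinuousSMul ℂ E] [LocallyConvexSpace ℝ E]
    [T2Space E] [BarrelledSpace ℂ E]
    (hE : ∀ u : ℕ → E, CauchySeq u → ∃ x : E, Tendsto u atTop (𝓝 x))
    (α : ℝ) (hα : 0 ≤ α) (C : E →L[ℂ] E) (S : ℝ → E →L[ℂ] E)
    (hS : IsIntegratedCSemigroup α C S)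
    (A : Submodule ℂ (E × E)) (hA : A = integralGenerator α C S) :
    ∃ G : TestFn →L[ℂ] (E →L[ℂ] E),
      (∀ (φ : TestFn) (x : E),
        HasVectorIntegral (fun t => weylDeriv α φ t • S t x) (Ioi 0) (G φ x)) ∧
      IsPreCDS C G ∧
      A ≤ distGenerator G := by
  obtain ⟨G, hG⟩ := exists_distribution hE hS.continuousOn (fun φ => weylDeriv α φ) ⌈α⌉₊
    (fun φ => continuous_weylDeriv α φ.contDiff φ.hasCompactSupport)
    (fun φ ψ t => weylDeriv_add α φ.contDiff φ.hasCompactSupport ψ.contDiff ψ.hasCompactSupport t)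
    (fun c φ t => weylDeriv_const_mul α c φ.contDiff φ.hasCompactSupport t)
    (fun φ R hR => weylDeriv_eq_zero α φ.contDiff φ.hasCompactSupport hR)
    (fun R _ => by
      obtain ⟨c, hc, h⟩ := exists_norm_weylDeriv_le α R
      exact ⟨c, hc, fun φ hφ M hM t ht =>
        h φ φ.contDiff φ.hasCompactSupport hφ M hM t ht.1⟩)
  exact ⟨G, hG, isPreCDS_of_hasVectorIntegral hα hS hG,
    hA ▸ integralGenerator_le_distGenerator hα hS hG⟩
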